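/- **Setting.** Let $M\ge 0$ and let $\rho>0$, $\mu>0$, $\lambda$ with $3\lambda+2\mu>0$, $\kappa_m>0$, $\tau_m>0$ ($m=1,\dots,M$) be constants. Let $\Omega\subset\mathbb R^3$ be open and bounded, $\Gamma_D\subset\partial\Omega$, $p\in\mathbb N$. Put $(a,b)=\int_\Omega a\cdot b\,dx$, $\epsilon(w)=\frac12(\nabla w+(\nabla w)^T)$, $e(w)=\epsilon(w)-\frac13\mathrm{tr}(\epsilon(w))I$, $$a_E(v,w)=(2\mu\,\epsilon(v)+\lambda\,\mathrm{tr}(\epsilon(v))I,\ \epsilon(w)),\qquad a_{VE}^m(v,w)=(\kappa_m e(v),e(w)),$$ and, for states $v=(v_1,v_0,(v_{VE}^m)_{m=1}^M)$, $$A(v,w)=\rho(v_1,w_1)+a_E(v_0,w_0)+\sum_m a_{VE}^m(v_{VE}^m,w_{VE}^m),$$ $$B(v,w)=a_E(v_0,w_1)-a_E(v_1,w_0)+\sum_m\bigl(a_{VE}^m(v_{VE}^m,w_1)-a_{VE}^m(v_1,w_{VE}^m)\bigr)+\sum_m\tfrac1{\tau_m}a_{VE}^m(v_{VE}^m,w_{VE}^m).$$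 Write $|||v|||_E^2=a_E(v,v)$, $|||v|||_{VE,m}^2=a_{VE}^m(v,v)$, $|||v|||_A^2=A(v,v)$. Let $\mathcal K_h$ be a conforming mesh of $\overline\Omega$ by finitely many tetrahedra (a finite simplicial complex with underlying set $\overline\Omega$, each of whose simplices is a face of a tetrahedron of the complex), and let $V_h$ be the space of continuous vector fields on $\overline\Omega$ whose components are polynomials of degree at most $p$ on each tetrahedron and which vanish on $\Gamma_D$. Let $\mathcal L_{h,E},\mathcal L_{h,VE}^m:V_h\to V_h$ be given by $(\mathcal L_{h,E}u,v)=a_E(u,v)$ and $(\mathcal L_{h,VE}^mu,v)=a_{VE}^m(u,v)$ for all $v\in V_h$, and put $\|z\|_{H^{-1}(\Omega)}=\sup_{0\ne w\in V_h}(z,w)/\|w\|_{H^1(\Omega)}$ for $z\in V_h$. Let $T>0$, $0=t_0<\dots<t_N=T$, $I_n=(t_{n-1},t_n]$, and let $P_0$ be the $L^2$-projection in time onto functions that are constant on each $I_n$. Given $\Psi=(\Psi_1,\Psi_0,\Psi_{VE})\in[V_h]^{2+M}$, a solution of the discrete dual problem is a $\Phi:[0,T]\to[V_h]^{2+M}$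 that is continuous in time, affine in time on each $I_n$, with $\Phi(T)=\Psi$ and $$\int_{I_n}-A(W,\dot\Phi)+B(W,\Phi)\,dt=0\qquad\text{for all } W\in[V_h]^{2+M},\ n=1,\dots,N.$$ $\|\cdot\|_{L^\infty(X)}$ denotes the supremum over $t\in[0,T]$ of the norm $X$ (for $\dot\Phi_1$: over all $t$ other than the nodes, where $\dot\Phi_1$ may be undefined). **Lemma (Properties of the Discrete Dual Problem).** There is a constant $C>0$, depending only on $\rho,\mu,\lambda,\kappa_m,\tau_m,M,\Omega,\Gamma_D,p$ (in particular not on the mesh, $T$ or the time steps), such that for all $\mathcal K_h$, $T$, $(t_n)$, $\Psi$ as above every solution $\Phi$ of the discrete dual problem satisfies: (i) for all $0\le i\le j\le N$, $$|||\Phi(t_i)|||_A^2+\sum_{m=1}^M\frac2{\tau_m}\int_{t_i}^{t_j}|||P_0\Phi_{VE}^m|||_{VE,m}^2\,dt=|||\Phi(t_j)|||_A^2;$$ (ii) $$\|\dot\Phi_1\|_{L^\infty(H^{-1}(\Omega))}^2+\|\Phi\|_{L^\infty(A)}^2+\sum_{m=1}^M\frac2{\tau_m}\int_0^T|||P_0\Phi_{VE}^m|||_{VE,m}^2\,dt\le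 C\,|||\Psi|||_A^2;$$ (iii) if $\Psi_1=0$ and $\Psi_{VE}^m=0$ for all $m$, then $$\|\dot\Phi_1\|_{L^\infty(L^2(\Omega))}^2+\Bigl\|\mathcal L_{h,E}\Phi_0+\sum_{m=1}^M\mathcal L_{h,VE}^m\Phi_{VE}^m\Bigr\|_{L^\infty(L^2(\Omega))}^2+\|\Phi_1\|_{L^\infty(E)}^2+\sum_{m=1}^M\|-\Phi_1+\tau_m^{-1}\Phi_{VE}^m\|_{L^\infty([VE,m])}^2\le C\,\|\mathcal L_{h,E}\Psi_0\|_{L^2(\Omega)}^2.$$ -/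

import Mathlib

open MeasureTheory Set
open scoped ENNReal

namespace Visco

noncomputable section

/-! ### Fields, strains and forms -/

abbrev E3 := EuclideanSpace ℝ (Fin 3)

/-- Vector fields on `ℝ³`. -/
abbrev Field := E3 → E3

abbrev Mat3 := Matrix (Fin 3) (Fin 3) ℝ

/-- Material parameters of the generalized Maxwell model with `M` arms: density `rho`, Lamé
parameters `mu`, `lam` (with the usual positivity of Hooke's law), elastic moduli `kappa m` and
relaxation times `tau m`. -/
structure Material (M : ℕ) where
  rho : ℝ
  mu : ℝ
  lam : ℝ
  kappa : Fin M → ℝ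
  tau : Fin M → ℝ
  rho_pos : 0 < rho
  mu_pos : 0 < mu
  bulk_pos : 0 < 3 * lam + 2 * mu
  kappa_pos : ∀ m, 0 < kappa m
  tau_pos : ∀ m, 0 < tau m

/-- The Jacobian matrix `(∂_j u_i (x))_{ij}`. For a continuous, piecewise polynomial field it is
defined at almost every point and is the weak gradient. -/
def grad (u : Field) (x : E3) : Mat3 :=
  Matrix.of fun i j => fderiv ℝ u x (EuclideanSpace.single j 1) i

/-- The linear strain of a field with Jacobian matrix `G`. -/
def strain (G : Mat3) : Mat3 := (1 / 2 : ℝ) • (G + G.transpose)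

/-- The deviatoric strain of a field with Jacobian matrix `G`. -/
def devStrain (G : Mat3) : Mat3 := strain G - ((1 / 3 : ℝ) * (strain G).trace) • 1

/-- Hooke's law applied to the strain of a field with Jacobian matrix `G`. -/
def stressE {M : ℕ} (P : Material M) (G : Mat3) : Mat3 :=
  (2 * P.mu) • strain G + (P.lam * (strain G).trace) • 1

/-- The viscoelastic stress of arm `m` of a field with Jacobian matrix `G`. -/
def stressVE {M : ℕ} (P : Material M) (m : Fin M) (G : Mat3) : Mat3 := P.kappa m • devStrain G

/-- The natural inner product of matrices. -/
def frob (A B : Mat3) : ℝ := ∑ i, ∑ j, A i j * B i j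

/-- The inner product of `[L²(Ω)]³`. -/
def l2 (Ω : Set E3) (u v : Field) : ℝ := ∫ x in Ω, inner ℝ (u x) (v x)

/-- The elastic form `a_E`. -/
def aE {M : ℕ} (P : Material M) (Ω : Set E3) (u v : Field) : ℝ :=
  ∫ x in Ω, frob (stressE P (grad u x)) (strain (grad v x))

/-- The viscoelastic form `a_VE^m`. -/
def aVE {M : ℕ} (P : Material M) (m : Fin M) (Ω : Set E3) (u v : Field) : ℝ :=
  ∫ x in Ω, frob (stressVE P m (grad u x)) (devStrain (grad v x))

/-- States `(v₁, v₀, v_VE)`: velocity, displacement and the `M` viscoelastic variables. -/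
abbrev State (M : ℕ) (V : Type) := V × V × (Fin M → V)

/-- The form `A`. -/
def formA {M : ℕ} (P : Material M) (Ω : Set E3) (u v : State M Field) : ℝ :=
  P.rho * l2 Ω u.1 v.1 + aE P Ω u.2.1 v.2.1 + ∑ m, aVE P m Ω (u.2.2 m) (v.2.2 m)

/-- The form `B`. -/
def formB {M : ℕ} (P : Material M) (Ω : Set E3) (u v : State M Field) : ℝ :=
  aE P Ω u.2.1 v.1 - aE P Ω u.1 v.2.1
    + ∑ m, (aVE P m Ω (u.2.2 m) v.1 - aVE P m Ω u.1 (v.2.2 m))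
    + ∑ m, (1 / P.tau m) * aVE P m Ω (u.2.2 m) (v.2.2 m)

/-! ### Norms -/

def normL2 (Ω : Set E3) (u : Field) : ℝ := √(l2 Ω u u)

def normH1 (Ω : Set E3) (u : Field) : ℝ :=
  √(l2 Ω u u + ∫ x in Ω, frob (grad u x) (grad u x))

def normE {M : ℕ} (P : Material M) (Ω : Set E3) (u : Field) : ℝ := √(aE P Ω u u)

def normVE {M : ℕ} (P : Material M) (m : Fin M) (Ω : Set E3) (u : Field) : ℝ :=
  √(aVE P m Ω u u)

def normA {M : ℕ} (P : Material M) (Ω : Set E3) (u : State M Field) : ℝ := √(formA P Ω u u)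

/-- The max norm in time over `I` of a time-dependent quantity with spatial norm `f s` at time
`s`, as an extended non-negative number. -/
def supNorm (I : Set ℝ) (f : ℝ → ℝ≥0∞) : ℝ≥0∞ := ⨆ s ∈ I, f s

/-! ### Meshes and finite element spaces -/

/-- A conforming tetrahedral mesh of `Ω`: a finite simplicial complex whose underlying space is the
closure of `Ω` and in which every simplex is a face of a tetrahedron. -/
structure TetMesh (Ω : Set E3) where
  complex : Geometry.SimplicialComplex ℝ E3
  finite : complex.faces.Finite
  space_eq : complex.space = closure Ω
  pure : ∀ s ∈ complex.faces, ∃ t ∈ complex.faces, s ⊆ t ∧ t.card = 4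

/-- The tetrahedra of the mesh, given by their sets of vertices. -/
def TetMesh.elements {Ω : Set E3} (K : TetMesh Ω) : Set (Finset E3) :=
  {s | s ∈ K.complex.faces ∧ s.card = 4}

/-- The vector field with polynomial components `q`. -/
def polyField (q : Fin 3 → MvPolynomial (Fin 3) ℝ) : Field :=
  fun x => WithLp.toLp 2 fun i => MvPolynomial.eval (fun j => x j) (q i)

/-- The finite element space `V_h`: fields that are continuous on the closure of `Ω`, have
polynomial components of degree at most `p` on every tetrahedron and vanish on `ΓD`. A field on the
closure of `Ω` is represented by its extension by zero. -/
def Vh {Ω : Set E3} (K : TetMesh Ω) (ΓD : Set E3) (p : ℕ) : Submodule ℝ Field where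
  carrier := {u | ContinuousOn u (closure Ω) ∧
    (∀ s ∈ K.elements, ∃ q : Fin 3 → MvPolynomial (Fin 3) ℝ,
      (∀ i, (q i).totalDegree ≤ p) ∧ ∀ x ∈ convexHull ℝ (s : Set E3), u x = polyField q x) ∧
    (∀ x ∈ ΓD, u x = 0) ∧ ∀ x ∉ closure Ω, u x = 0}
  add_mem' := by
    rintro u v ⟨hu1, hu2, hu3, hu4⟩ ⟨hv1, hv2, hv3, hv4⟩
    refine ⟨hu1.add hv1, fun s hs => ?_, fun x hx => ?_, fun x hx => ?_⟩
    · obtain ⟨q, hq, hq'⟩ := hu2 s hs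
      obtain ⟨r, hr, hr'⟩ := hv2 s hs
      refine ⟨q + r, fun i => (MvPolynomial.totalDegree_add _ _).trans (max_le (hq i) (hr i)),
        fun x hx => ?_⟩
      ext i
      simp [hq' x hx, hr' x hx, polyField]
    · simp [hu3 x hx, hv3 x hx]
    · simp [hu4 x hx, hv4 x hx]
  zero_mem' := by
    refine ⟨continuousOn_const, fun s _ => ⟨0, fun i => by simp, fun x _ => ?_⟩, fun x _ => rfl,
      fun x _ => rfl⟩
    ext i
    simp [polyField]
  smul_mem' := by
    rintro c u ⟨hu1, hu2, hu3, hu4⟩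
    refine ⟨hu1.const_smul c, fun s hs => ?_, fun x hx => ?_, fun x hx => ?_⟩
    · obtain ⟨q, hq, hq'⟩ := hu2 s hs
      refine ⟨c • q, fun i => (MvPolynomial.totalDegree_smul_le _ _).trans (hq i), fun x hx => ?_⟩
      ext i
      simp [hq' x hx, polyField]
    · simp [hu3 x hx]
    · simp [hu4 x hx]

/-- The `H⁻¹`-norm on finite element functions: the supremum of `(z, w) / ‖w‖_{H¹}` over the
nonzero `w` in `V_h`. -/
def normHm1 {Ω : Set E3} (K : TetMesh Ω) (ΓD : Set E3) (p : ℕ) (z : Field) : ℝ≥0∞ :=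
  ⨆ w : Vh K ΓD p, ⨆ _ : w ≠ 0, ENNReal.ofReal (l2 Ω z w / normH1 Ω w)

/-- The state of fields underlying a state of finite element functions. -/
def State.fields {M : ℕ} {Ω : Set E3} {K : TetMesh Ω} {ΓD : Set E3} {p : ℕ}
    (u : State M (Vh K ΓD p)) : State M Field :=
  (u.1, u.2.1, fun m => u.2.2 m)

/-! ### Auxiliary facts: the forms are bilinear on `V_h` and the `L²` form is nondegenerate -/

section Aux

variable {Ω : Set E3} (K : TetMesh Ω) (ΓD : Set E3) (p : ℕ)

lemma contDiff_polyField (q : Fin 3 → MvPolynomial (Fin 3) ℝ) : ContDiff ℝ 1 (polyField q) := by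
  rw [contDiff_euclidean]
  intro i
  change ContDiff ℝ 1 fun x : E3 => MvPolynomial.eval (fun j => x j) (q i)
  induction q i using MvPolynomial.induction_on with
  | C a => simpa using contDiff_const
  | add f g hf hg => simpa using hf.add hg
  | mul_X f j hf =>
    simp only [map_mul, MvPolynomial.eval_X]
    exact hf.mul (contDiff_euclidean.1 contDiff_id j)

lemma closure_eq : closure Ω = ⋃ s ∈ K.elements, convexHull ℝ (s : Set E3) := by
  rw [← K.space_eq]
  ext x
  simp only [Geometry.SimplicialComplex.mem_space_iff, mem_iUnion, exists_prop]
  constructor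
  · rintro ⟨s, hs, hx⟩
    obtain ⟨t, ht, hst, hc⟩ := K.pure s hs
    exact ⟨t, ⟨ht, hc⟩, convexHull_mono (by exact_mod_cast hst) hx⟩
  · rintro ⟨s, hs, hx⟩
    exact ⟨s, hs.1, hx⟩

lemma elements_finite : K.elements.Finite := K.finite.subset fun _ h => h.1

lemma isCompact_hull (s : Finset E3) : IsCompact (convexHull ℝ (s : Set E3)) :=
  s.finite_toSet.isCompact_convexHull (𝕜 := ℝ)

lemma interior_ae_eq (s : Finset E3) :
    interior (convexHull ℝ (s : Set E3)) =ᵐ[volume] convexHull ℝ (s : Set E3) :=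
  interior_ae_eq_of_null_frontier ((convex_convexHull ℝ _).addHaar_frontier _)

lemma ae_mem_interior : ∀ᵐ x ∂(volume.restrict Ω),
    ∃ s ∈ K.elements, x ∈ interior (convexHull ℝ (s : Set E3)) := by
  have h : ∀ᵐ x ∂(volume : Measure E3), ∀ s ∈ K.elements,
      x ∈ convexHull ℝ (s : Set E3) → x ∈ interior (convexHull ℝ (s : Set E3)) := by
    rw [ae_ball_iff (elements_finite K).countable]
    intro s _
    filter_upwards [(interior_ae_eq s).mem_iff] with x hx using hx.2
  have h2 : ∀ᵐ x ∂(volume.restrict (closure Ω)), x ∈ closure Ω :=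
    ae_restrict_mem isClosed_closure.measurableSet
  have h2' := ae_restrict_of_ae_restrict_of_subset (subset_closure (s := Ω)) h2
  filter_upwards [ae_restrict_of_ae h, h2'] with x hx hx2
  rw [closure_eq K] at hx2
  simp only [mem_iUnion, exists_prop] at hx2
  obtain ⟨s, hs, hxs⟩ := hx2
  exact ⟨s, hs, hx s hs hxs⟩

lemma integrableOn_of_piecewise {f : E3 → ℝ} (hf : ∀ s ∈ K.elements, ∃ g : E3 → ℝ, Continuous g ∧
    ∀ x ∈ interior (convexHull ℝ (s : Set E3)), f x = g x) : IntegrableOn f Ω := by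
  refine IntegrableOn.mono_set ?_ subset_closure
  rw [closure_eq K, integrableOn_finite_biUnion (elements_finite K)]
  intro s hs
  obtain ⟨g, hg, hfg⟩ := hf s hs
  have h1 : IntegrableOn g (interior (convexHull ℝ (s : Set E3))) :=
    (hg.continuousOn.integrableOn_compact (isCompact_hull s)).mono_set interior_subset
  have h2 : IntegrableOn f (interior (convexHull ℝ (s : Set E3))) :=
    h1.congr_fun (fun x hx => (hfg x hx).symm) isOpen_interior.measurableSet
  exact h2.congr_set_ae (interior_ae_eq s).symm

variable {K ΓD p}

lemma eventuallyEq_poly {u : Field} {s : Finset E3} {q : Fin 3 → MvPolynomial (Fin 3) ℝ}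
    (h : ∀ x ∈ convexHull ℝ (s : Set E3), u x = polyField q x) {x : E3}
    (hx : x ∈ interior (convexHull ℝ (s : Set E3))) : u =ᶠ[nhds x] polyField q := by
  filter_upwards [isOpen_interior.mem_nhds hx] with y hy using h y (interior_subset hy)

lemma ae_differentiableAt {u : Field} (hu : u ∈ Vh K ΓD p) :
    ∀ᵐ x ∂(volume.restrict Ω), DifferentiableAt ℝ u x := by
  filter_upwards [ae_mem_interior K] with x ⟨s, hs, hx⟩
  obtain ⟨q, -, hq⟩ := hu.2.1 s hs
  exact (((contDiff_polyField q).differentiable (by simp)) x).congr_of_eventuallyEq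
    (eventuallyEq_poly hq hx)

lemma grad_add_ae {u v : Field} (hu : u ∈ Vh K ΓD p) (hv : v ∈ Vh K ΓD p) :
    ∀ᵐ x ∂(volume.restrict Ω), grad (u + v) x = grad u x + grad v x := by
  filter_upwards [ae_differentiableAt hu, ae_differentiableAt hv] with x hx hy
  ext i j
  simp [grad, fderiv_add hx hy]

lemma grad_smul_ae (c : ℝ) {u : Field} (hu : u ∈ Vh K ΓD p) :
    ∀ᵐ x ∂(volume.restrict Ω), grad (c • u) x = c • grad u x := by
  filter_upwards [ae_differentiableAt hu] with x hx
  ext i j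
  simp [grad, fderiv_const_smul hx]

lemma integrableOn_grad (F : LinearMap.BilinForm ℝ Mat3) {u v : Field} (hu : u ∈ Vh K ΓD p)
    (hv : v ∈ Vh K ΓD p) : IntegrableOn (fun x => F (grad u x) (grad v x)) Ω := by
  refine integrableOn_of_piecewise K fun s hs => ?_
  obtain ⟨q, -, hq⟩ := hu.2.1 s hs
  obtain ⟨r, -, hr⟩ := hv.2.1 s hs
  have hgrad : ∀ q : Fin 3 → MvPolynomial (Fin 3) ℝ, Continuous (grad (polyField q)) := by
    intro q
    refine continuous_matrix fun i j => ?_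
    have := ((contDiff_polyField q).continuous_fderiv (by simp)).clm_apply
      (continuous_const (y := (EuclideanSpace.single j 1 : E3)))
    exact (EuclideanSpace.proj (𝕜 := ℝ) i).continuous.comp this
  have key : ∀ A B : Mat3, F A B = ∑ i, ∑ j, ∑ k, ∑ l,
      A i j * B k l * F (Matrix.single i j 1) (Matrix.single k l 1) := by
    intro A B
    have h1 : ∀ C : Mat3, C = ∑ i, ∑ j, C i j • (Matrix.single i j 1 : Mat3) := by
      intro C
      conv_lhs => rw [Matrix.matrix_eq_sum_single C]
      simp [Matrix.smul_single]
    have h2 : ∀ f : Mat3 →ₗ[ℝ] ℝ, f B = ∑ k, ∑ l, B k l * f (Matrix.single k l 1) := by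
      intro f
      conv_lhs => rw [h1 B]
      simp only [map_sum, map_smul, smul_eq_mul]
    have h3 : F A B = ∑ i, ∑ j, A i j * F (Matrix.single i j 1) B := by
      conv_lhs => rw [h1 A]
      simp only [map_sum, map_smul, LinearMap.sum_apply, LinearMap.smul_apply, smul_eq_mul]
    rw [h3]
    refine Finset.sum_congr rfl fun i _ => Finset.sum_congr rfl fun j _ => ?_
    rw [h2, Finset.mul_sum]
    refine Finset.sum_congr rfl fun k _ => ?_
    rw [Finset.mul_sum]
    exact Finset.sum_congr rfl fun l _ => by ring
  refine ⟨fun x => F (grad (polyField q) x) (grad (polyField r) x), ?_, fun x hx => ?_⟩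
  · have hij : ∀ (q : Fin 3 → MvPolynomial (Fin 3) ℝ) (i j : Fin 3),
        Continuous fun x => grad (polyField q) x i j := fun q i j => (hgrad q).matrix_elem i j
    refine Continuous.congr ?_ fun x => (key (grad (polyField q) x) (grad (polyField r) x)).symm
    refine continuous_finsetSum _ fun i _ => continuous_finsetSum _ fun j _ =>
      continuous_finsetSum _ fun k _ => continuous_finsetSum _ fun l _ => ?_
    exact ((hij q i j).mul (hij r k l)).mul continuous_const
  · have h1 : grad u x = grad (polyField q) x := by
      ext i j; simp [grad, (eventuallyEq_poly hq hx).fderiv_eq]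
    have h2 : grad v x = grad (polyField r) x := by
      ext i j; simp [grad, (eventuallyEq_poly hr hx).fderiv_eq]
    rw [h1, h2]

variable (K ΓD p)

/-- The bilinear form on `V_h` obtained by integrating a bilinear form of the gradients. -/
def gradForm (F : LinearMap.BilinForm ℝ Mat3) : LinearMap.BilinForm ℝ (Vh K ΓD p) :=
  LinearMap.mk₂ ℝ (fun u v => ∫ x in Ω, F (grad u x) (grad v x))
    (fun u v w => by
      rw [← integral_add (integrableOn_grad F u.2 w.2) (integrableOn_grad F v.2 w.2)]
      refine integral_congr_ae ?_
      filter_upwards [grad_add_ae u.2 v.2] with x hx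
      simp [hx])
    (fun c u v => by
      rw [smul_eq_mul, ← integral_const_mul]
      refine integral_congr_ae ?_
      filter_upwards [grad_smul_ae c u.2] with x hx
      simp [hx])
    (fun u v w => by
      rw [← integral_add (integrableOn_grad F u.2 v.2) (integrableOn_grad F u.2 w.2)]
      refine integral_congr_ae ?_
      filter_upwards [grad_add_ae v.2 w.2] with x hx
      simp [hx])
    (fun c u v => by
      rw [smul_eq_mul, ← integral_const_mul]
      refine integral_congr_ae ?_
      filter_upwards [grad_smul_ae c v.2] with x hx
      simp [hx])

lemma strain_add (G H : Mat3) : strain (G + H) = strain G + strain H := by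
  simp only [strain, Matrix.transpose_add]; module

lemma strain_smul (c : ℝ) (G : Mat3) : strain (c • G) = c • strain G := by
  simp only [strain, Matrix.transpose_smul]; module

lemma devStrain_add (G H : Mat3) : devStrain (G + H) = devStrain G + devStrain H := by
  simp only [devStrain, strain_add, Matrix.trace_add]; module

lemma devStrain_smul (c : ℝ) (G : Mat3) : devStrain (c • G) = c • devStrain G := by
  simp only [devStrain, strain_smul, Matrix.trace_smul, smul_eq_mul]; module

lemma stressE_add {M : ℕ} (P : Material M) (G H : Mat3) :
    stressE P (G + H) = stressE P G + stressE P H := by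
  simp only [stressE, strain_add, Matrix.trace_add]; module

lemma stressE_smul {M : ℕ} (P : Material M) (c : ℝ) (G : Mat3) :
    stressE P (c • G) = c • stressE P G := by
  simp only [stressE, strain_smul, Matrix.trace_smul, smul_eq_mul]; module

lemma frob_add_left (A B C : Mat3) : frob (A + B) C = frob A C + frob B C := by
  simp [frob, add_mul, Finset.sum_add_distrib]

lemma frob_add_right (A B C : Mat3) : frob A (B + C) = frob A B + frob A C := by
  simp [frob, mul_add, Finset.sum_add_distrib]

lemma frob_smul_left (c : ℝ) (A B : Mat3) : frob (c • A) B = c * frob A B := by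
  simp [frob, Finset.mul_sum, mul_assoc]

lemma frob_smul_right (c : ℝ) (A B : Mat3) : frob A (c • B) = c * frob A B := by
  simp [frob, Finset.mul_sum, mul_left_comm]

/-- The integrand of `a_E` as a bilinear form of the Jacobian matrices. -/
def densityE {M : ℕ} (P : Material M) : LinearMap.BilinForm ℝ Mat3 :=
  LinearMap.mk₂ ℝ (fun G H => frob (stressE P G) (strain H))
    (fun G H J => by simp only [stressE_add, frob_add_left])
    (fun c G H => by simp only [stressE_smul, frob_smul_left, smul_eq_mul])
    (fun G H J => by simp only [strain_add, frob_add_right])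
    (fun c G H => by simp only [strain_smul, frob_smul_right, smul_eq_mul])

/-- The integrand of `a_VE^m` as a bilinear form of the Jacobian matrices. -/
def densityVE {M : ℕ} (P : Material M) (m : Fin M) : LinearMap.BilinForm ℝ Mat3 :=
  LinearMap.mk₂ ℝ (fun G H => frob (stressVE P m G) (devStrain H))
    (fun G H J => by simp only [stressVE, devStrain_add, smul_add, frob_add_left])
    (fun c G H => by
      simp only [stressVE, devStrain_smul, frob_smul_left, smul_eq_mul]; ring)
    (fun G H J => by simp only [devStrain_add, frob_add_right])
    (fun c G H => by simp only [devStrain_smul, frob_smul_right, smul_eq_mul])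

/-- `a_E` as a bilinear form on `V_h`. -/
def aEForm {M : ℕ} (P : Material M) : LinearMap.BilinForm ℝ (Vh K ΓD p) :=
  gradForm K ΓD p (densityE P)

/-- `a_VE^m` as a bilinear form on `V_h`. -/
def aVEForm {M : ℕ} (P : Material M) (m : Fin M) : LinearMap.BilinForm ℝ (Vh K ΓD p) :=
  gradForm K ΓD p (densityVE P m)

lemma aEForm_apply {M : ℕ} (P : Material M) (u v : Vh K ΓD p) :
    aEForm K ΓD p P u v = aE P Ω u v := rfl

lemma aVEForm_apply {M : ℕ} (P : Material M) (m : Fin M) (u v : Vh K ΓD p) :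
    aVEForm K ΓD p P m u v = aVE P m Ω u v := rfl

variable {K ΓD p}

lemma integrableOn_inner {u v : Field} (hu : u ∈ Vh K ΓD p) (hv : v ∈ Vh K ΓD p) :
    IntegrableOn (fun x => inner ℝ (u x) (v x)) Ω := by
  refine integrableOn_of_piecewise K fun s hs => ?_
  obtain ⟨q, -, hq⟩ := hu.2.1 s hs
  obtain ⟨r, -, hr⟩ := hv.2.1 s hs
  refine ⟨fun x => inner ℝ (polyField q x) (polyField r x),
    (contDiff_polyField q).continuous.inner (contDiff_polyField r).continuous, fun x hx => ?_⟩
  rw [hq x (interior_subset hx), hr x (interior_subset hx)]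

variable (K ΓD p)

/-- The `L²` inner product as a bilinear form on `V_h`. -/
def l2Form : LinearMap.BilinForm ℝ (Vh K ΓD p) :=
  LinearMap.mk₂ ℝ (fun u v => l2 Ω u v)
    (fun u v w => by
      simp only [l2]
      rw [← integral_add (integrableOn_inner u.2 w.2) (integrableOn_inner v.2 w.2)]
      simp [inner_add_left])
    (fun c u v => by
      simp only [l2]
      rw [smul_eq_mul, ← integral_const_mul]
      simp [inner_smul_left])
    (fun u v w => by
      simp only [l2]
      rw [← integral_add (integrableOn_inner u.2 v.2) (integrableOn_inner u.2 w.2)]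
      simp [inner_add_right])
    (fun c u v => by
      simp only [l2]
      rw [smul_eq_mul, ← integral_const_mul]
      simp [inner_smul_right])

lemma l2Form_apply (u v : Vh K ΓD p) : l2Form K ΓD p u v = l2 Ω u v := rfl

lemma l2Form_definite (hΩ : IsOpen Ω) (u : Vh K ΓD p) (hu : l2 Ω u u = 0) : u = 0 := by
  have h0 : (fun x => inner ℝ ((u : Field) x) ((u : Field) x)) =ᵐ[volume.restrict Ω] 0 :=
    (integral_eq_zero_iff_of_nonneg (fun x => real_inner_self_nonneg)
      (integrableOn_inner u.2 u.2)).1 hu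
  have h1 : (u : Field) =ᵐ[volume.restrict Ω] fun _ => (0 : E3) := by
    filter_upwards [h0] with x hx using inner_self_eq_zero.1 hx
  have h2 : EqOn (u : Field) (fun _ => 0) Ω :=
    Measure.eqOn_open_of_ae_eq h1 hΩ (u.2.1.mono subset_closure) continuousOn_const
  have h3 : EqOn (u : Field) (fun _ => 0) (closure Ω) :=
    h2.of_subset_closure u.2.1 continuousOn_const subset_closure le_rfl
  ext1
  funext x
  by_cases hx : x ∈ closure Ω
  · exact h3 hx
  · exact u.2.2.2.2 x hx

lemma l2Form_nondegenerate (hΩ : IsOpen Ω) : (l2Form K ΓD p).Nondegenerate :=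
  ⟨fun u h => l2Form_definite K ΓD p hΩ u (h u), fun u h => l2Form_definite K ΓD p hΩ u (h u)⟩

/-- The polynomial fields of degree at most `p`, as functions on a set. -/
def polyOn (S : Set E3) : (Fin 3 → MvPolynomial.restrictTotalDegree (Fin 3) ℝ p) →ₗ[ℝ] (S → E3) where
  toFun q x := polyField (fun i => (q i : MvPolynomial (Fin 3) ℝ)) x
  map_add' q r := by
    funext x; ext i; simp [polyField]
  map_smul' c q := by
    funext x; ext i; simp [polyField]

instance finiteDimensional_Vh : FiniteDimensional ℝ (Vh K ΓD p) := by
  have : Finite K.elements := elements_finite K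
  let R : Vh K ΓD p →ₗ[ℝ] ((s : K.elements) →
      LinearMap.range (polyOn p (convexHull ℝ ((s : Finset E3) : Set E3)))) :=
    { toFun := fun u s => ⟨fun x => (u : Field) x, by
        obtain ⟨q, hq, hq'⟩ := u.2.2.1 s s.2
        refine ⟨fun i => ⟨q i, (MvPolynomial.mem_restrictTotalDegree _ _ _).2 (hq i)⟩, ?_⟩
        funext x
        exact (hq' x x.2).symm⟩
      map_add' := fun u v => by funext s; ext1; rfl
      map_smul' := fun c u => by funext s; ext1; rfl }
  refine FiniteDimensional.of_injective R fun u v huv => ?_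
  ext1
  funext x
  by_cases hx : x ∈ closure Ω
  · rw [closure_eq K] at hx
    simp only [mem_iUnion, exists_prop] at hx
    obtain ⟨s, hs, hxs⟩ := hx
    have h1 := congrFun huv ⟨s, hs⟩
    exact congrFun (congrArg Subtype.val h1) ⟨x, hxs⟩
  · rw [u.2.2.2.2 x hx, v.2.2.2.2 x hx]

end Aux

/-! ### Discrete differential operators -/

/-- The operator `L : V_h → V_h` with `(L u, v) = a(u, v)` for all `v ∈ V_h`. -/
def discreteOp {Ω : Set E3} (hΩ : IsOpen Ω) (K : TetMesh Ω) (ΓD : Set E3) (p : ℕ)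
    (a : LinearMap.BilinForm ℝ (Vh K ΓD p)) : Vh K ΓD p →ₗ[ℝ] Vh K ΓD p :=
  ((l2Form K ΓD p).toDual (l2Form_nondegenerate K ΓD p hΩ)).symm.toLinearMap ∘ₗ a

lemma discreteOp_spec {Ω : Set E3} (hΩ : IsOpen Ω) (K : TetMesh Ω) (ΓD : Set E3) (p : ℕ)
    (a : LinearMap.BilinForm ℝ (Vh K ΓD p)) (u v : Vh K ΓD p) :
    l2 Ω (discreteOp hΩ K ΓD p a u) v = a u v := by
  rw [← l2Form_apply]
  exact LinearMap.BilinForm.apply_toDual_symm_apply (hB := l2Form_nondegenerate K ΓD p hΩ) (a u) v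

/-- The operator `L_{h,E}`. -/
def opE {M : ℕ} (P : Material M) {Ω : Set E3} (hΩ : IsOpen Ω) (K : TetMesh Ω) (ΓD : Set E3)
    (p : ℕ) : Vh K ΓD p →ₗ[ℝ] Vh K ΓD p :=
  discreteOp hΩ K ΓD p (aEForm K ΓD p P)

/-- The operator `L_{h,VE}^m`. -/
def opVE {M : ℕ} (P : Material M) (m : Fin M) {Ω : Set E3} (hΩ : IsOpen Ω) (K : TetMesh Ω)
    (ΓD : Set E3) (p : ℕ) : Vh K ΓD p →ₗ[ℝ] Vh K ΓD p :=
  discreteOp hΩ K ΓD p (aVEForm K ΓD p P m)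

/-! ### Time discretization and the discrete dual problem -/

/-- A partition `0 = t_0 < t_1 < ⋯ < t_N = T`. -/
structure TimeMesh (T : ℝ) where
  N : ℕ
  node : Fin (N + 1) → ℝ
  strictMono : StrictMono node
  node_zero : node 0 = 0
  node_last : node (Fin.last N) = T

/-- The projection `P_0` onto functions that are constant in time on every interval
`(t_{n-1}, t_n]`, where it takes the mean value of `v` over the interval. -/
def projP0 {T : ℝ} (τ : TimeMesh T) (v : ℝ → Field) (s : ℝ) : Field := fun x =>
  ∑ n : Fin τ.N, (Ioc (τ.node n.castSucc) (τ.node n.succ)).indicator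
    (fun _ => ⨍ r in Ioc (τ.node n.castSucc) (τ.node n.succ), v r x) s

/-- The time derivative of a time-dependent field. -/
def fieldDeriv (v : ℝ → Field) (s : ℝ) : Field := fun x => deriv (fun r => v r x) s

/-- The time derivative of a time-dependent state. -/
def stateDeriv {M : ℕ} (Φ : ℝ → State M Field) (s : ℝ) : State M Field :=
  (fieldDeriv (fun r => (Φ r).1) s, fieldDeriv (fun r => (Φ r).2.1) s,
    fun m => fieldDeriv (fun r => (Φ r).2.2 m) s)

/-- `Φ` solves the discrete dual problem with data `Ψ` at the final time `T`: it is continuous on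
`[0, T]`, affine in time with values in `[V_h]^{2+M}` on every time interval, and satisfies the
variational equation on every time interval for all test states that are constant in time. -/
structure IsDualSolution {M : ℕ} (P : Material M) {Ω : Set E3} {K : TetMesh Ω} {ΓD : Set E3}
    {p : ℕ} {T : ℝ} (τ : TimeMesh T) (Ψ : State M (Vh K ΓD p)) (Φ : ℝ → State M (Vh K ΓD p)) :
    Prop where
  final : Φ T = Ψ
  affine : ∀ n : Fin τ.N, ∃ a b : State M (Vh K ΓD p),
    ∀ s ∈ Icc (τ.node n.castSucc) (τ.node n.succ), Φ s = a + s • b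
  equation : ∀ n : Fin τ.N, ∀ W : State M (Vh K ΓD p),
    ∫ s in (τ.node n.castSucc)..(τ.node n.succ),
      (-formA P Ω W.fields (stateDeriv (fun r => (Φ r).fields) s)
        + formB P Ω W.fields (Φ s).fields) = 0

end

end Visco

/-! On a time interval $\Phi=a+sb$ is affine, so integrating the equation gives
$A(W,b)=B(W,\Phi(\bar t))$ with $\bar t$ the midpoint (`IsDualSolution.exists_slope`): the scheme is
a midpoint rule. With the operator $S$ defined by $A(W,Su)=B(W,u)$ (`generator`, `formAh_generator`)
it reads $b=S\Phi(\bar t)$ modulo the kernel of $A$.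

Energy balance: the increment of $A(\Phi,\Phi)$ over an interval of length $k$ is exactly
$2k\,A(\Phi(\bar t),b)=2k\,B(\Phi(\bar t),\Phi(\bar t))$ (`bilin_affine`). The skew part of $B$
cancels on the diagonal (`formBh_self`), leaving the dissipation at $\Phi_{VE}(\bar
t)=P_0\Phi_{VE}$. Summation gives (i). Between nodes the energy is a convex quadratic in time, hence
bounded by its value at $T$ (`bilin_le_final`). The $H^{-1}$-bound follows by testing with $(w,0,0)$
and applying Cauchy–Schwarz for $A$ (`normHm1_le`).

For (iii) the same argument is applied to $S\Phi$, which is affine with slope $Sb$: $A(S\Phi(\bar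
t),Sb)=B(S\Phi(\bar t),b)=B(S\Phi(\bar t),S\Phi(\bar t))\ge 0$. So $A(S\Phi,S\Phi)\le
A(S\Psi,S\Psi)$ (`IsDualSolution.generator_energy_le`), and the components of $S\Phi$ control the
quantities in (iii).

$A$ is only semidefinite, since $a_E$ and $a_{VE}^m$ may vanish on nonzero fields. Replacing $b$ by
$S\Phi(\bar t)$ inside $B$ is therefore justified by `formBh_eq_of_formAh_eq`. Neither Korn's
inequality nor an inverse estimate enters, and the constant depends on the material alone. -/

namespace Visco
noncomputable section

/-! ### Densities -/

/-- Orthogonal splitting into deviatoric and volumetric parts. Both coefficients, $2\mu$ and the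
bulk modulus $\lambda+\frac23\mu$, are positive even when $\lambda<0$; positivity of $a_E$ and its
comparison with $a_{VE}^m$ are read off from this form. -/
lemma frob_stressE {M : ℕ} (P : Material M) (G H : Mat3) :
    frob (stressE P G) (strain H) = 2 * P.mu * frob (devStrain G) (devStrain H)
      + (P.lam + 2 * P.mu / 3) * ((strain G).trace * (strain H).trace) := by
  simp [frob, stressE, devStrain, strain, Fin.sum_univ_three, Matrix.trace, Matrix.one_apply]
  ring

lemma frob_comm (A B : Mat3) : frob A B = frob B A := by
  simp [frob, mul_comm]

lemma frob_self_nonneg (A : Mat3) : 0 ≤ frob A A :=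
  Finset.sum_nonneg fun _ _ => Finset.sum_nonneg fun _ _ => mul_self_nonneg _

/-- Symmetrization and removal of the trace are orthogonal projections for the Frobenius product;
the squares below are the discarded components. -/
lemma frob_devStrain_le (G : Mat3) : frob (devStrain G) (devStrain G) ≤ frob G G := by
  simp [frob, devStrain, strain, Fin.sum_univ_three, Matrix.trace, Matrix.one_apply]
  nlinarith [sq_nonneg (G 0 1 - G 1 0), sq_nonneg (G 0 2 - G 2 0), sq_nonneg (G 1 2 - G 2 1),
    sq_nonneg (G 0 0 + G 1 1 + G 2 2)]

lemma trace_strain_sq_le (G : Mat3) : (strain G).trace * (strain G).trace ≤ 3 * frob G G := by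
  simp [frob, strain, Fin.sum_univ_three, Matrix.trace]
  nlinarith [sq_nonneg (G 0 0 - G 1 1), sq_nonneg (G 0 0 - G 2 2), sq_nonneg (G 1 1 - G 2 2),
    sq_nonneg (G 0 1), sq_nonneg (G 0 2), sq_nonneg (G 1 2), sq_nonneg (G 1 0),
    sq_nonneg (G 2 0), sq_nonneg (G 2 1)]

section Forms

variable {M : ℕ} (P : Material M)

lemma Material.bulk_pos' : 0 < P.lam + 2 * P.mu / 3 := by linarith [P.bulk_pos]

lemma densityE_apply (G H : Mat3) : densityE P G H = frob (stressE P G) (strain H) := rfl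

lemma densityVE_apply (m : Fin M) (G H : Mat3) :
    densityVE P m G H = P.kappa m * frob (devStrain G) (devStrain H) :=
  frob_smul_left _ _ _

lemma densityE_symm (G H : Mat3) : densityE P G H = densityE P H G := by
  rw [densityE_apply, densityE_apply, frob_stressE, frob_stressE, frob_comm]; ring

lemma densityVE_symm (m : Fin M) (G H : Mat3) : densityVE P m G H = densityVE P m H G := by
  rw [densityVE_apply, densityVE_apply, frob_comm]

lemma densityVE_nonneg (m : Fin M) (G : Mat3) : 0 ≤ densityVE P m G G := by
  rw [densityVE_apply]
  exact mul_nonneg (P.kappa_pos m).le (frob_self_nonneg _)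

lemma densityE_nonneg (G : Mat3) : 0 ≤ densityE P G G := by
  rw [densityE_apply, frob_stressE]
  have h1 := mul_nonneg P.mu_pos.le (frob_self_nonneg (devStrain G))
  have h2 := mul_nonneg P.bulk_pos'.le (mul_self_nonneg (strain G).trace)
  linarith

lemma densityVE_le_densityE (m : Fin M) (G : Mat3) :
    densityVE P m G G ≤ (P.kappa m / (2 * P.mu)) * densityE P G G := by
  have hmu := P.mu_pos
  rw [densityE_apply, frob_stressE, densityVE_apply, mul_add]
  have h2 := mul_nonneg P.bulk_pos'.le (mul_self_nonneg (strain G).trace)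
  have h3 := mul_nonneg (div_nonneg (P.kappa_pos m).le (by positivity : 0 ≤ 2 * P.mu)) h2
  have h4 : P.kappa m / (2 * P.mu) * (2 * P.mu * frob (devStrain G) (devStrain G))
      = P.kappa m * frob (devStrain G) (devStrain G) := by field_simp
  linarith

/-- The constant is $2\mu\cdot 1+(\lambda+\frac23\mu)\cdot 3$, from the two parts of `frob_stressE`.
-/
lemma densityE_le (G : Mat3) : densityE P G G ≤ (4 * P.mu + 3 * P.lam) * frob G G := by
  rw [densityE_apply, frob_stressE]
  have h1 := mul_le_mul_of_nonneg_left (frob_devStrain_le G) P.mu_pos.le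
  have h2 := mul_le_mul_of_nonneg_left (trace_strain_sq_le G) P.bulk_pos'.le
  linarith

lemma densityVE_le (m : Fin M) (G : Mat3) : densityVE P m G G ≤ P.kappa m * frob G G := by
  rw [densityVE_apply]
  exact mul_le_mul_of_nonneg_left (frob_devStrain_le G) (P.kappa_pos m).le

/-- The natural inner product of matrices as a bilinear form. -/
def frobForm : LinearMap.BilinForm ℝ Mat3 :=
  LinearMap.mk₂ ℝ frob frob_add_left (fun c A B => by simp [frob_smul_left])
    frob_add_right (fun c A B => by simp [frob_smul_right])

/-! ### Symmetry, positivity and comparison of the integrated forms on $V_h$ -/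

variable {Ω : Set E3} (K : TetMesh Ω) (ΓD : Set E3) (p : ℕ)

lemma gradForm_symm {F : LinearMap.BilinForm ℝ Mat3} (hF : ∀ G H, F G H = F H G)
    (u v : Vh K ΓD p) : gradForm K ΓD p F u v = gradForm K ΓD p F v u :=
  integral_congr_ae (ae_of_all _ fun _ => hF _ _)

lemma gradForm_nonneg {F : LinearMap.BilinForm ℝ Mat3} (hF : ∀ G, 0 ≤ F G G)
    (u : Vh K ΓD p) : 0 ≤ gradForm K ΓD p F u u :=
  integral_nonneg fun _ => hF _

lemma gradForm_mono {F F' : LinearMap.BilinForm ℝ Mat3} {c : ℝ}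
    (hF : ∀ G, F G G ≤ c * F' G G) (u : Vh K ΓD p) :
    gradForm K ΓD p F u u ≤ c * gradForm K ΓD p F' u u := by
  change ∫ x in Ω, F (grad u x) (grad u x) ≤ c * ∫ x in Ω, F' (grad u x) (grad u x)
  rw [← integral_const_mul]
  exact integral_mono (integrableOn_grad F u.2 u.2) ((integrableOn_grad F' u.2 u.2).const_mul c)
    fun x => hF _

lemma l2Form_symm (u v : Vh K ΓD p) : l2Form K ΓD p u v = l2Form K ΓD p v u :=
  integral_congr_ae (ae_of_all _ fun _ => real_inner_comm _ _)

lemma l2Form_nonneg (u : Vh K ΓD p) : 0 ≤ l2Form K ΓD p u u :=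
  integral_nonneg fun _ => real_inner_self_nonneg

lemma gradForm_frob_le_normH1_sq (u : Vh K ΓD p) :
    gradForm K ΓD p frobForm u u ≤ normH1 Ω u ^ 2 := by
  have h1 := l2Form_nonneg K ΓD p u
  have h2 := gradForm_nonneg K ΓD p (F := frobForm) frob_self_nonneg u
  change _ ≤ √(l2Form K ΓD p u u + gradForm K ΓD p frobForm u u) ^ 2
  rw [Real.sq_sqrt (add_nonneg h1 h2)]
  exact le_add_of_nonneg_left h1

lemma aEForm_nonneg (u : Vh K ΓD p) : 0 ≤ aEForm K ΓD p P u u :=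
  gradForm_nonneg K ΓD p (densityE_nonneg P) u

lemma aVEForm_nonneg (m : Fin M) (u : Vh K ΓD p) : 0 ≤ aVEForm K ΓD p P m u u :=
  gradForm_nonneg K ΓD p (densityVE_nonneg P m) u

lemma aEForm_symm (u v : Vh K ΓD p) : aEForm K ΓD p P u v = aEForm K ΓD p P v u :=
  gradForm_symm K ΓD p (densityE_symm P) u v

lemma aVEForm_symm (m : Fin M) (u v : Vh K ΓD p) :
    aVEForm K ΓD p P m u v = aVEForm K ΓD p P m v u :=
  gradForm_symm K ΓD p (densityVE_symm P m) u v

lemma aVEForm_le_aEForm (m : Fin M) (u : Vh K ΓD p) :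
    aVEForm K ΓD p P m u u ≤ P.kappa m / (2 * P.mu) * aEForm K ΓD p P u u :=
  gradForm_mono K ΓD p (densityVE_le_densityE P m) u

/-! ### The forms `A` and `B` on finite element states -/

/-- `A` as a bilinear form on finite element states. -/
def formAh : LinearMap.BilinForm ℝ (State M (Vh K ΓD p)) :=
  LinearMap.mk₂ ℝ (fun u v => P.rho * l2Form K ΓD p u.1 v.1 + aEForm K ΓD p P u.2.1 v.2.1
      + ∑ m, aVEForm K ΓD p P m (u.2.2 m) (v.2.2 m))
    (fun u v w => by simp [Finset.sum_add_distrib]; ring)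
    (fun c u v => by simp [Finset.mul_sum, mul_add]; ring)
    (fun u v w => by simp [Finset.sum_add_distrib]; ring)
    (fun c u v => by simp [Finset.mul_sum, mul_add]; ring)

/-- `B` as a bilinear form on finite element states. -/
def formBh : LinearMap.BilinForm ℝ (State M (Vh K ΓD p)) :=
  LinearMap.mk₂ ℝ (fun u v => aEForm K ΓD p P u.2.1 v.1 - aEForm K ΓD p P u.1 v.2.1
      + ∑ m, (aVEForm K ΓD p P m (u.2.2 m) v.1 - aVEForm K ΓD p P m u.1 (v.2.2 m))
      + ∑ m, (1 / P.tau m) * aVEForm K ΓD p P m (u.2.2 m) (v.2.2 m))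
    (fun u v w => by
      simp [Finset.sum_add_distrib, mul_add]; ring)
    (fun c u v => by
      simp only [Prod.smul_fst, Prod.smul_snd, Pi.smul_apply, map_smul, LinearMap.smul_apply,
        smul_eq_mul, Finset.mul_sum, mul_add, mul_sub]
      simp only [mul_left_comm])
    (fun u v w => by
      simp [Finset.sum_add_distrib, mul_add]; ring)
    (fun c u v => by
      simp only [Prod.smul_fst, Prod.smul_snd, Pi.smul_apply, map_smul,
        smul_eq_mul, Finset.mul_sum, mul_add, mul_sub]
      simp only [mul_left_comm])

variable {K ΓD p}

lemma formAh_apply (u v : State M (Vh K ΓD p)) :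
    formAh P K ΓD p u v = P.rho * l2Form K ΓD p u.1 v.1 + aEForm K ΓD p P u.2.1 v.2.1
      + ∑ m, aVEForm K ΓD p P m (u.2.2 m) (v.2.2 m) := rfl

lemma formBh_apply (u v : State M (Vh K ΓD p)) :
    formBh P K ΓD p u v = aEForm K ΓD p P u.2.1 v.1 - aEForm K ΓD p P u.1 v.2.1
      + ∑ m, (aVEForm K ΓD p P m (u.2.2 m) v.1 - aVEForm K ΓD p P m u.1 (v.2.2 m))
      + ∑ m, (1 / P.tau m) * aVEForm K ΓD p P m (u.2.2 m) (v.2.2 m) := rfl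

lemma formAh_symm (u v : State M (Vh K ΓD p)) :
    formAh P K ΓD p u v = formAh P K ΓD p v u := by
  simp only [formAh_apply]
  rw [l2Form_symm, aEForm_symm]
  simp only [aVEForm_symm P K ΓD p _ (u.2.2 _)]

lemma formAh_nonneg (u : State M (Vh K ΓD p)) : 0 ≤ formAh P K ΓD p u u :=
  add_nonneg (add_nonneg (mul_nonneg P.rho_pos.le (l2Form_nonneg K ΓD p _))
    (aEForm_nonneg P K ΓD p _)) (Finset.sum_nonneg fun m _ => aVEForm_nonneg P K ΓD p m _)

lemma rho_l2Form_le_formAh (u : State M (Vh K ΓD p)) :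
    P.rho * l2Form K ΓD p u.1 u.1 ≤ formAh P K ΓD p u u := by
  have h1 := aEForm_nonneg P K ΓD p u.2.1
  have h2 := Finset.sum_nonneg fun m (_ : m ∈ Finset.univ) => aVEForm_nonneg P K ΓD p m (u.2.2 m)
  rw [formAh_apply]; linarith

lemma aEForm_le_formAh (u : State M (Vh K ΓD p)) :
    aEForm K ΓD p P u.2.1 u.2.1 ≤ formAh P K ΓD p u u := by
  have h1 := mul_nonneg P.rho_pos.le (l2Form_nonneg K ΓD p u.1)
  have h2 := Finset.sum_nonneg fun m (_ : m ∈ Finset.univ) => aVEForm_nonneg P K ΓD p m (u.2.2 m)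
  rw [formAh_apply]; linarith

lemma aVEForm_le_formAh (m : Fin M) (u : State M (Vh K ΓD p)) :
    aVEForm K ΓD p P m (u.2.2 m) (u.2.2 m) ≤ formAh P K ΓD p u u := by
  have h1 := mul_nonneg P.rho_pos.le (l2Form_nonneg K ΓD p u.1)
  have h2 := aEForm_nonneg P K ΓD p u.2.1
  have h3 := Finset.single_le_sum
    (fun m (_ : m ∈ Finset.univ) => aVEForm_nonneg P K ΓD p m (u.2.2 m)) (Finset.mem_univ m)
  rw [formAh_apply]; linarith

lemma formBh_self (u : State M (Vh K ΓD p)) :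
    formBh P K ΓD p u u = ∑ m, (1 / P.tau m) * aVEForm K ΓD p P m (u.2.2 m) (u.2.2 m) := by
  rw [formBh_apply, aEForm_symm]
  simp only [aVEForm_symm P K ΓD p _ u.1, sub_self, Finset.sum_const_zero, zero_add]

lemma formBh_self_nonneg (u : State M (Vh K ΓD p)) : 0 ≤ formBh P K ΓD p u u := by
  rw [formBh_self]
  exact Finset.sum_nonneg fun m _ => mul_nonneg (one_div_pos.2 (P.tau_pos m)).le
    (aVEForm_nonneg P K ΓD p m _)

/-- The kernel of `A` is contained in the kernel of `B`. -/
lemma formBh_eq_of_formAh_eq (hΩ : IsOpen Ω) {u v : State M (Vh K ΓD p)}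
    (h : ∀ W, formAh P K ΓD p W u = formAh P K ΓD p W v) (W : State M (Vh K ΓD p)) :
    formBh P K ΓD p W u = formBh P K ΓD p W v := by
  classical
  -- Only the $L^2$ part of $A$ is definite, so only the first components are shown to be equal. The
  -- others agree up to the kernels of $a_E$ and $a_{VE}^m$, which suffices because $B$ sees them
  -- only through these forms.
  have h1 : ∀ w, l2Form K ΓD p w u.1 = l2Form K ΓD p w v.1 := fun w => by
    have := h (w, 0, 0)
    simpa [formAh_apply, P.rho_pos.ne'] using this
  have h1' : u.1 = v.1 := by
    rw [← sub_eq_zero]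
    refine l2Form_definite K ΓD p hΩ _ ?_
    rw [← l2Form_apply, map_sub, h1, sub_self]
  have h2 : ∀ w, aEForm K ΓD p P w u.2.1 = aEForm K ΓD p P w v.2.1 := fun w => by
    have := h (0, w, 0)
    simpa [formAh_apply] using this
  have h3 : ∀ m w, aVEForm K ΓD p P m w (u.2.2 m) = aVEForm K ΓD p P m w (v.2.2 m) := by
    intro m w
    have := h (0, 0, Pi.single m w)
    simp only [formAh_apply, map_zero, LinearMap.zero_apply, mul_zero, zero_add] at this
    rw [Finset.sum_eq_single m, Finset.sum_eq_single m] at this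
    · simpa using this
    all_goals simp +contextual
  simp only [formBh_apply, h1', h2, h3]

/-! ### The generator of the dual problem -/

variable (K ΓD p)

/-- The operator `S` with `A(W, S u) = B(W, u)`. -/
def generator (hΩ : IsOpen Ω) : State M (Vh K ΓD p) →ₗ[ℝ] State M (Vh K ΓD p) where
  -- When $A$ is degenerate its equation does not determine $S$. This choice has as components the
  -- discrete stress divergence and the velocity that (iii) estimates; in the last components the
  -- sign of $u_1$ is opposite to that in (iii).
  toFun u := (-(P.rho⁻¹ • (opE P hΩ K ΓD p u.2.1 + ∑ m, opVE P m hΩ K ΓD p (u.2.2 m))), u.1,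
    fun m => u.1 + (P.tau m)⁻¹ • u.2.2 m)
  map_add' u v := by
    refine Prod.ext ?_ (Prod.ext rfl (funext fun m => ?_))
    · simp only [Prod.fst_add, Prod.snd_add, Pi.add_apply, map_add, Finset.sum_add_distrib]
      module
    · simp only [Prod.fst_add, Prod.snd_add, Pi.add_apply]
      module
  map_smul' c u := by
    refine Prod.ext ?_ (Prod.ext rfl (funext fun m => ?_))
    · simp only [Prod.smul_fst, Prod.smul_snd, Pi.smul_apply, map_smul, ← Finset.smul_sum,
        RingHom.id_apply]
      module
    · simp only [Prod.smul_fst, Prod.smul_snd, Pi.smul_apply, RingHom.id_apply]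
      module

variable {K ΓD p}

lemma generator_apply (hΩ : IsOpen Ω) (u : State M (Vh K ΓD p)) :
    generator P K ΓD p hΩ u =
      (-(P.rho⁻¹ • (opE P hΩ K ΓD p u.2.1 + ∑ m, opVE P m hΩ K ΓD p (u.2.2 m))), u.1,
        fun m => u.1 + (P.tau m)⁻¹ • u.2.2 m) := rfl

lemma formAh_generator (hΩ : IsOpen Ω) (W u : State M (Vh K ΓD p)) :
    formAh P K ΓD p W (generator P K ΓD p hΩ u) = formBh P K ΓD p W u := by
  have hE : ∀ z w, l2Form K ΓD p w (opE P hΩ K ΓD p z) = aEForm K ΓD p P w z := fun z w => by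
    rw [l2Form_symm, l2Form_apply, opE, discreteOp_spec, aEForm_symm]
  have hV : ∀ m z w, l2Form K ΓD p w (opVE P m hΩ K ΓD p z) = aVEForm K ΓD p P m w z :=
    fun m z w => by rw [l2Form_symm, l2Form_apply, opVE, discreteOp_spec, aVEForm_symm]
  rw [formAh_apply, formBh_apply, generator_apply]
  simp only [map_neg, map_smul, map_add, map_sum, hE, hV, smul_eq_mul, Finset.sum_add_distrib,
    Finset.sum_sub_distrib, one_div]
  have := P.rho_pos.ne'
  field_simp
  ring

end Forms

/-! ### Quadratic forms along piecewise affine functions -/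

section Time

variable {W : Type*} [AddCommGroup W] [Module ℝ W] (A : LinearMap.BilinForm ℝ W)

/-- The time derivative of the quadratic is affine, so the midpoint rule integrates it without
error. This is what makes the discrete energy balance an identity. -/
lemma bilin_affine (hA : ∀ u v, A u v = A v u) (a b : W) (s t : ℝ) :
    A (a + t • b) (a + t • b) - A (a + s • b) (a + s • b)
      = 2 * (t - s) * A (a + ((s + t) / 2) • b) b := by
  simp only [map_add, map_smul, LinearMap.add_apply, LinearMap.smul_apply, smul_eq_mul, hA b a]
  ring

/-- Convexity in time: the maximum over the interval is at an endpoint, and by `h` the right one is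
the larger. -/
lemma bilin_affine_le (hA : ∀ u v, A u v = A v u) (hp : ∀ u, 0 ≤ A u u) (a b : W) {r s t : ℝ}
    (hr : r < t) (hs : s ∈ Icc r t)
    (h : A (a + r • b) (a + r • b) ≤ A (a + t • b) (a + t • b)) :
    A (a + s • b) (a + s • b) ≤ A (a + t • b) (a + t • b) := by
  have h1 := mul_nonneg (mul_nonneg (sub_nonneg.2 hs.1) (sub_nonneg.2 hs.2)) (hp b)
  have h2 := mul_nonneg (sub_nonneg.2 hs.2) (sub_nonneg.2 h)
  have h3 : 0 < t - r := sub_pos.2 hr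
  rw [← sub_nonneg]
  -- With $f(x)=A(a+xb,a+xb)$: $(t-r)(f(t)-f(s))=(t-s)(f(t)-f(r))+(t-r)(s-r)(t-s)A(b,b)$.
  refine (mul_nonneg_iff_of_pos_left h3).1 ?_
  simp only [map_add, map_smul, LinearMap.add_apply, LinearMap.smul_apply, smul_eq_mul,
    hA b a] at h2 ⊢
  nlinarith [mul_nonneg h3.le h1]

variable {T : ℝ} (τ : TimeMesh T)

lemma TimeMesh.castSucc_lt_succ (n : Fin τ.N) : τ.node n.castSucc < τ.node n.succ :=
  τ.strictMono Fin.castSucc_lt_succ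

lemma TimeMesh.exists_mem_Icc {s : ℝ} (hT : 0 < T) (hs : s ∈ Icc 0 T) :
    ∃ n : Fin τ.N, s ∈ Icc (τ.node n.castSucc) (τ.node n.succ) := by
  have h : ∀ k : Fin (τ.N + 1), 0 < k → s ≤ τ.node k →
      ∃ n : Fin τ.N, s ∈ Icc (τ.node n.castSucc) (τ.node n.succ) := by
    intro k
    induction k using Fin.induction with
    | zero => intro h; exact absurd h (lt_irrefl _)
    | succ i ih =>
      intro _ hi
      rcases le_total (τ.node i.castSucc) s with h | h
      · exact ⟨i, h, hi⟩
      · rcases eq_or_ne i.castSucc 0 with h0 | h0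
        · exact ⟨i, by rw [h0, τ.node_zero]; exact hs.1, hi⟩
        · exact ih (Fin.pos_iff_ne_zero.2 h0) h
  -- Since $T>0$, the last node differs from node $0$, so there is at least one interval.
  refine h (Fin.last _) ?_ (by rw [τ.node_last]; exact hs.2)
  rw [← τ.strictMono.lt_iff_lt, τ.node_zero, τ.node_last]
  exact hT

/-- If a non-negative quadratic form of a piecewise affine function is nondecreasing from node to
node, then it is bounded by its value at the final time. -/
lemma bilin_le_final (hA : ∀ u v, A u v = A v u) (hp : ∀ u, 0 ≤ A u u) (hT : 0 < T) {X : ℝ → W}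
    (haff : ∀ n : Fin τ.N, ∃ a b : W,
      ∀ s ∈ Icc (τ.node n.castSucc) (τ.node n.succ), X s = a + s • b)
    (hmono : ∀ n : Fin τ.N, A (X (τ.node n.castSucc)) (X (τ.node n.castSucc))
      ≤ A (X (τ.node n.succ)) (X (τ.node n.succ))) {s : ℝ} (hs : s ∈ Icc 0 T) :
    A (X s) (X s) ≤ A (X T) (X T) := by
  obtain ⟨n, hn⟩ := τ.exists_mem_Icc hT hs
  have hlt := τ.castSucc_lt_succ n
  have hm : Monotone fun k => A (X (τ.node k)) (X (τ.node k)) := Fin.monotone_iff_le_succ.2 hmono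
  refine le_trans ?_ ((hm (Fin.le_last n.succ)).trans_eq (by simp only [τ.node_last]))
  obtain ⟨a, b, hab⟩ := haff n
  have h := hmono n
  simp only [hab _ hn, hab _ (left_mem_Icc.2 hlt.le), hab _ (right_mem_Icc.2 hlt.le)] at h ⊢
  exact bilin_affine_le A hA hp a b hlt hn h

end Time

lemma supNorm_sq_le {I : Set ℝ} {f : ℝ → ℝ≥0∞} {c : ℝ} (hc : 0 ≤ c)
    (h : ∀ s ∈ I, f s ≤ ENNReal.ofReal √c) : supNorm I f ^ 2 ≤ ENNReal.ofReal c := by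
  calc supNorm I f ^ 2 ≤ ENNReal.ofReal √c ^ 2 := by
        gcongr
        exact iSup₂_le h
    _ = ENNReal.ofReal c := by rw [← ENNReal.ofReal_pow (Real.sqrt_nonneg _), Real.sq_sqrt hc]

/-! ### Solutions of the dual problem: midpoint equation, energy balance, energy of $S\Phi$ -/

section Dual

variable {M : ℕ} {P : Material M} {Ω : Set E3} {K : TetMesh Ω} {ΓD : Set E3} {p : ℕ} {T : ℝ}
  {τ : TimeMesh T} {Ψ : State M (Vh K ΓD p)} {Φ : ℝ → State M (Vh K ΓD p)}

lemma fieldDeriv_affine {v : ℝ → Vh K ΓD p} {a b : Vh K ΓD p} {r t s : ℝ}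
    (h : ∀ x ∈ Icc r t, v x = a + x • b) (hs : s ∈ Ioo r t) :
    fieldDeriv (fun x => (v x : Field)) s = b := by
  funext y
  have h1 : (fun x => (v x : Field) y) =ᶠ[nhds s] fun x => (a : Field) y + x • (b : Field) y := by
    filter_upwards [Ioo_mem_nhds hs.1 hs.2] with x hx
    rw [h x ⟨hx.1.le, hx.2.le⟩]
    rfl
  have h2 : HasDerivAt (fun x : ℝ => (a : Field) y + x • (b : Field) y) ((b : Field) y) s := by
    simpa using ((hasDerivAt_id s).smul_const ((b : Field) y)).const_add ((a : Field) y)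
  rw [fieldDeriv, h1.deriv_eq, h2.deriv]

lemma stateDeriv_affine {a b : State M (Vh K ΓD p)} {r t s : ℝ}
    (h : ∀ x ∈ Icc r t, Φ x = a + x • b) (hs : s ∈ Ioo r t) :
    stateDeriv (fun x => (Φ x).fields) s = b.fields := by
  refine Prod.ext ?_ (Prod.ext ?_ (funext fun m => ?_))
  · exact fieldDeriv_affine (v := fun x => (Φ x).1) (a := a.1) (b := b.1)
      (fun x hx => by rw [h x hx]; rfl) hs
  · exact fieldDeriv_affine (v := fun x => (Φ x).2.1) (a := a.2.1) (b := b.2.1)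
      (fun x hx => by rw [h x hx]; rfl) hs
  · exact fieldDeriv_affine (v := fun x => (Φ x).2.2 m) (a := a.2.2 m) (b := b.2.2 m)
      (fun x hx => by rw [h x hx]; rfl) hs

lemma setAverage_affine {E : Type*} [NormedAddCommGroup E] [NormedSpace ℝ E] [CompleteSpace E]
    {v : ℝ → E} {a b : E} {r t : ℝ} (hrt : r < t) (h : ∀ x ∈ Icc r t, v x = a + x • b) :
    ⨍ x in Ioc r t, v x = a + ((r + t) / 2) • b := by
  have h1 : ∫ x in r..t, v x = (t - r) • a + ((t ^ 2 - r ^ 2) / 2) • b := by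
    rw [intervalIntegral.integral_congr (g := fun x => a + x • b)
      fun x hx => h x (by rwa [uIcc_of_le hrt.le] at hx),
      intervalIntegral.integral_add (by simp) (Continuous.intervalIntegrable (by fun_prop) _ _),
      intervalIntegral.integral_const, intervalIntegral.integral_smul_const, integral_id]
  rw [setAverage_eq, ← intervalIntegral.integral_of_le hrt.le, h1, Real.volume_real_Ioc_of_le hrt.le,
    smul_add, smul_smul, smul_smul, inv_mul_cancel₀ (sub_pos.2 hrt).ne', one_smul]
  congr 2
  have := (sub_pos.2 hrt).ne'
  field_simp
  ring

/-- On every time interval, a solution of the dual problem is affine and satisfies the equation at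
the midpoint. -/
lemma IsDualSolution.exists_slope (h : IsDualSolution P τ Ψ Φ) (n : Fin τ.N) :
    ∃ a b : State M (Vh K ΓD p),
      (∀ s ∈ Icc (τ.node n.castSucc) (τ.node n.succ), Φ s = a + s • b) ∧
      ∀ W, formAh P K ΓD p W b
        = formBh P K ΓD p W (a + ((τ.node n.castSucc + τ.node n.succ) / 2) • b) := by
  obtain ⟨a, b, hab⟩ := h.affine n
  have hlt := τ.castSucc_lt_succ n
  refine ⟨a, b, hab, fun W => ?_⟩
  have h1 := h.equation n W
  set r := τ.node n.castSucc
  set t := τ.node n.succ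
  have h2 : ∫ s in r..t, (-formAh P K ΓD p W b + formBh P K ΓD p W (a + s • b)) = 0 := by
    rw [← h1]
    refine intervalIntegral.integral_congr_ae ?_
    -- At the right endpoint $\Phi$ may have a kink, and the two-sided derivative need not be the
    -- slope; one point is negligible.
    filter_upwards [(Measure.ae_ne volume t : ∀ᵐ s, s ≠ t)] with s hst hs
    rw [uIoc_of_le hlt.le] at hs
    rw [stateDeriv_affine hab ⟨hs.1, lt_of_le_of_ne hs.2 hst⟩, hab s ⟨hs.1.le, hs.2⟩]
    rfl
  simp only [map_add, map_smul, smul_eq_mul, ← add_assoc] at h2 ⊢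
  rw [intervalIntegral.integral_add (by simp) (Continuous.intervalIntegrable (by fun_prop) _ _),
    intervalIntegral.integral_const, intervalIntegral.integral_mul_const, integral_id,
    smul_eq_mul] at h2
  have h3 : t - r ≠ 0 := (sub_pos.2 hlt).ne'
  apply mul_left_cancel₀ h3
  linear_combination -h2

/-- The mean of an affine function is its midpoint value. This is why the dissipation in the energy
balance involves $P_0\Phi_{VE}^m$ rather than $\Phi_{VE}^m$. -/
lemma IsDualSolution.projP0_eq {a b : State M (Vh K ΓD p)} {n : Fin τ.N}
    (hab : ∀ s ∈ Icc (τ.node n.castSucc) (τ.node n.succ), Φ s = a + s • b) (m : Fin M) {s : ℝ}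
    (hs : s ∈ Ioc (τ.node n.castSucc) (τ.node n.succ)) :
    projP0 τ (fun r => (Φ r).2.2 m) s
      = ((a + ((τ.node n.castSucc + τ.node n.succ) / 2) • b).2.2 m : Vh K ΓD p) := by
  have hlt := τ.castSucc_lt_succ n
  funext x
  rw [projP0, Finset.sum_eq_single n]
  · rw [indicator_of_mem hs]
    exact setAverage_affine (a := (a.2.2 m : Field) x) (b := (b.2.2 m : Field) x) hlt
      fun r hr => by rw [hab r hr]; rfl
  -- The half-open intervals are disjoint, so the other summands vanish at `s`.
  · intro k _ hk
    refine indicator_of_notMem (fun hks => ?_) _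
    rcases lt_or_gt_of_ne hk with hkn | hkn
    · have : τ.node k.succ ≤ τ.node n.castSucc := τ.strictMono.monotone (by simpa using hkn)
      exact absurd (hks.2.trans this) (not_le.2 hs.1)
    · have : τ.node n.succ ≤ τ.node k.castSucc := τ.strictMono.monotone (by simpa using hkn)
      exact absurd (hs.2.trans this) (not_le.2 hks.1)
  · simp

lemma normVE_sq (m : Fin M) (u : Vh K ΓD p) :
    normVE P m Ω u ^ 2 = aVEForm K ΓD p P m u u :=
  Real.sq_sqrt (aVEForm_nonneg P K ΓD p m u)

lemma normA_sq (u : State M (Vh K ΓD p)) : normA P Ω u.fields ^ 2 = formAh P K ΓD p u u :=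
  Real.sq_sqrt (formAh_nonneg P u)

lemma eqOn_normVE_projP0 {a b : State M (Vh K ΓD p)} {n : Fin τ.N}
    (hab : ∀ s ∈ Icc (τ.node n.castSucc) (τ.node n.succ), Φ s = a + s • b) (m : Fin M) {c : ℝ}
    (hc : c = aVEForm K ΓD p P m
        ((a + ((τ.node n.castSucc + τ.node n.succ) / 2) • b).2.2 m)
        ((a + ((τ.node n.castSucc + τ.node n.succ) / 2) • b).2.2 m)) :
    EqOn (fun _ => c) (fun s => normVE P m Ω (projP0 τ (fun r => (Φ r).2.2 m) s) ^ 2)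
      (uIoc (τ.node n.castSucc) (τ.node n.succ)) := by
  intro s hs
  rw [uIoc_of_le (τ.castSucc_lt_succ n).le] at hs
  simp only [IsDualSolution.projP0_eq hab m hs, normVE_sq, hc]

lemma IsDualSolution.intervalIntegrable_step (h : IsDualSolution P τ Ψ Φ) (m : Fin M)
    (n : Fin τ.N) :
    IntervalIntegrable (fun s => normVE P m Ω (projP0 τ (fun r => (Φ r).2.2 m) s) ^ 2) volume
      (τ.node n.castSucc) (τ.node n.succ) := by
  obtain ⟨a, b, hab, -⟩ := h.exists_slope n
  exact (intervalIntegrable_const (μ := volume)).congr (eqOn_normVE_projP0 hab m rfl)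

/-- The energy balance over one time interval. -/
lemma IsDualSolution.energy_step (h : IsDualSolution P τ Ψ Φ) (n : Fin τ.N) :
    formAh P K ΓD p (Φ (τ.node n.castSucc)) (Φ (τ.node n.castSucc))
      + ∑ m, 2 / P.tau m * ∫ s in (τ.node n.castSucc)..(τ.node n.succ),
          normVE P m Ω (projP0 τ (fun r => (Φ r).2.2 m) s) ^ 2
      = formAh P K ΓD p (Φ (τ.node n.succ)) (Φ (τ.node n.succ)) := by
  obtain ⟨a, b, hab, heq⟩ := h.exists_slope n
  have hlt := τ.castSucc_lt_succ n
  have h1 : ∀ m, ∫ s in (τ.node n.castSucc)..(τ.node n.succ),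
      normVE P m Ω (projP0 τ (fun r => (Φ r).2.2 m) s) ^ 2
      = (τ.node n.succ - τ.node n.castSucc) * aVEForm K ΓD p P m
        ((a + ((τ.node n.castSucc + τ.node n.succ) / 2) • b).2.2 m)
        ((a + ((τ.node n.castSucc + τ.node n.succ) / 2) • b).2.2 m) := fun m => by
    rw [← intervalIntegral.integral_congr_ae (ae_of_all _ (eqOn_normVE_projP0 hab m rfl)),
      intervalIntegral.integral_const, smul_eq_mul]
  -- The increment is $2(t-r)A(\Phi(\bar t),b)=2(t-r)B(\Phi(\bar t),\Phi(\bar t))$, the second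
  -- equality being the equation tested with $W=\Phi(\bar t)$.
  rw [← eq_sub_iff_add_eq', hab _ (left_mem_Icc.2 hlt.le), hab _ (right_mem_Icc.2 hlt.le),
    bilin_affine _ (formAh_symm P), heq, formBh_self, Finset.mul_sum]
  refine Finset.sum_congr rfl fun m _ => ?_
  rw [h1]
  ring

lemma IsDualSolution.intervalIntegrable_energy (h : IsDualSolution P τ Ψ Φ) (m : Fin M)
    (i j : Fin (τ.N + 1)) (hij : i ≤ j) :
    IntervalIntegrable (fun s => normVE P m Ω (projP0 τ (fun r => (Φ r).2.2 m) s) ^ 2) volume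
      (τ.node i) (τ.node j) := by
  induction j using Fin.induction with
  | zero => rw [Fin.le_zero_iff.1 hij]
  | succ k ih =>
    rcases hij.eq_or_lt with rfl | hlt
    · exact IntervalIntegrable.refl
    · exact (ih (Fin.le_castSucc_iff.2 hlt)).trans (h.intervalIntegrable_step m k)

/-- The energy balance of a solution of the dual problem. -/
lemma IsDualSolution.energy (h : IsDualSolution P τ Ψ Φ) (i j : Fin (τ.N + 1)) (hij : i ≤ j) :
    formAh P K ΓD p (Φ (τ.node i)) (Φ (τ.node i))
      + ∑ m, 2 / P.tau m * ∫ s in (τ.node i)..(τ.node j),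
          normVE P m Ω (projP0 τ (fun r => (Φ r).2.2 m) s) ^ 2
      = formAh P K ΓD p (Φ (τ.node j)) (Φ (τ.node j)) := by
  induction j using Fin.induction with
  | zero => rw [Fin.le_zero_iff.1 hij]; simp
  | succ k ih =>
    rcases hij.eq_or_lt with rfl | hlt
    · simp
    · have hik := Fin.le_castSucc_iff.2 hlt
      rw [← h.energy_step k, ← ih hik, add_assoc, ← Finset.sum_add_distrib]
      congr 1
      refine Finset.sum_congr rfl fun m _ => ?_
      rw [← mul_add, intervalIntegral.integral_add_adjacent_intervals
        (h.intervalIntegrable_energy m i _ hik) (h.intervalIntegrable_step m k)]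

lemma integral_normVE_nonneg (v : ℝ → Field) (m : Fin M) {r t : ℝ} (hrt : r ≤ t) :
    0 ≤ 2 / P.tau m * ∫ s in r..t, normVE P m Ω (v s) ^ 2 :=
  mul_nonneg (div_nonneg zero_le_two (P.tau_pos m).le)
    (intervalIntegral.integral_nonneg hrt fun _ _ => sq_nonneg _)

lemma IsDualSolution.energy_le (h : IsDualSolution P τ Ψ Φ) (hT : 0 < T) {s : ℝ}
    (hs : s ∈ Icc 0 T) : formAh P K ΓD p (Φ s) (Φ s) ≤ formAh P K ΓD p Ψ Ψ := by
  rw [← h.final]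
  refine bilin_le_final (formAh P K ΓD p) τ (formAh_symm P) (formAh_nonneg P) hT h.affine (fun n => ?_) hs
  rw [← h.energy_step n]
  exact le_add_of_nonneg_right (Finset.sum_nonneg fun m _ =>
    integral_normVE_nonneg _ m (τ.castSucc_lt_succ n).le)

/-- The energy of `S Φ` is bounded by its value at the final time. -/
lemma IsDualSolution.generator_energy_le (h : IsDualSolution P τ Ψ Φ) (hΩ : IsOpen Ω) (hT : 0 < T)
    {s : ℝ} (hs : s ∈ Icc 0 T) :
    formAh P K ΓD p (generator P K ΓD p hΩ (Φ s)) (generator P K ΓD p hΩ (Φ s))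
      ≤ formAh P K ΓD p (generator P K ΓD p hΩ Ψ) (generator P K ΓD p hΩ Ψ) := by
  rw [← h.final]
  refine bilin_le_final (formAh P K ΓD p) τ (formAh_symm P) (formAh_nonneg P) hT
    (X := fun s => generator P K ΓD p hΩ (Φ s)) (fun n => ?_) (fun n => ?_) hs
  · obtain ⟨a, b, hab⟩ := h.affine n
    exact ⟨generator P K ΓD p hΩ a, generator P K ΓD p hΩ b, fun s hs => by
      simp only [hab s hs, map_add, map_smul]⟩
  · obtain ⟨a, b, hab, heq⟩ := h.exists_slope n
    have hlt := τ.castSucc_lt_succ n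
    rw [← sub_nonneg, hab _ (left_mem_Icc.2 hlt.le), hab _ (right_mem_Icc.2 hlt.le)]
    simp only [map_add (generator P K ΓD p hΩ), map_smul (generator P K ΓD p hΩ)]
    rw [bilin_affine _ (formAh_symm P), formAh_generator]
    refine mul_nonneg (mul_nonneg zero_le_two (sub_nonneg.2 hlt.le)) ?_
    -- It remains to sign $B(S\Phi(\bar t),b)$. As $b$ and $S\Phi(\bar t)$ have the same
    -- $A$-products with every state, $b$ may be exchanged for $S\Phi(\bar t)$ in $B$, which gives a
    -- diagonal value.
    rw [← map_smul (generator P K ΓD p hΩ), ← map_add (generator P K ΓD p hΩ),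
      formBh_eq_of_formAh_eq P hΩ (fun W => (heq W).trans (formAh_generator P hΩ W _).symm)]
    exact formBh_self_nonneg P _

/-- Away from the nodes, the time derivative of `Φ₁` is the first component of a state `b` with
`A(W, b) = B(W, Φ(s'))` for some time `s'`. -/
lemma IsDualSolution.exists_fieldDeriv (h : IsDualSolution P τ Ψ Φ) (hT : 0 < T) {s : ℝ}
    (hs : s ∈ Icc 0 T \ range τ.node) :
    ∃ b : State M (Vh K ΓD p), ∃ s' ∈ Icc 0 T,
      fieldDeriv (fun r => (Φ r).1) s = b.1 ∧
      ∀ W, formAh P K ΓD p W b = formBh P K ΓD p W (Φ s') := by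
  obtain ⟨n, hn⟩ := τ.exists_mem_Icc hT hs.1
  obtain ⟨a, b, hab, heq⟩ := h.exists_slope n
  have hlt := τ.castSucc_lt_succ n
  have h0 : 0 ≤ τ.node n.castSucc := by
    rw [← τ.node_zero]; exact τ.strictMono.monotone (Fin.zero_le _)
  have hT' : τ.node n.succ ≤ T :=
    (τ.strictMono.monotone (Fin.le_last _)).trans_eq τ.node_last
  have hmid : (τ.node n.castSucc + τ.node n.succ) / 2
      ∈ Icc (τ.node n.castSucc) (τ.node n.succ) := ⟨by linarith, by linarith⟩
  -- The time `s'` is the midpoint of the interval containing `s`; excluding the nodes puts `s` in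
  -- its interior.
  refine ⟨b, (τ.node n.castSucc + τ.node n.succ) / 2, ⟨h0.trans hmid.1, hmid.2.trans hT'⟩, ?_,
    fun W => by rw [heq, hab _ hmid]⟩
  refine fieldDeriv_affine (v := fun x => (Φ x).1) (a := a.1) (fun x hx => by rw [hab x hx]; rfl)
    ⟨lt_of_le_of_ne hn.1 fun hh => hs.2 ⟨_, hh⟩, lt_of_le_of_ne hn.2 fun hh => hs.2 ⟨_, hh.symm⟩⟩

end Dual

/-- The constant of the bound of `a_E + ∑ a_VE^m` by the square of the `H¹`-norm. -/
def Material.bound {M : ℕ} (P : Material M) : ℝ := 4 * P.mu + 3 * P.lam + ∑ m, P.kappa m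

lemma Material.bound_nonneg {M : ℕ} (P : Material M) : 0 ≤ P.bound := by
  have h1 := Finset.sum_nonneg fun m (_ : m ∈ Finset.univ) => (P.kappa_pos m).le
  have := P.bulk_pos
  have := P.mu_pos
  rw [Material.bound]
  linarith

/-! ### Estimates for a single state -/

section Estimates

variable {M : ℕ} (P : Material M) {Ω : Set E3} {K : TetMesh Ω} {ΓD : Set E3} {p : ℕ}

lemma formAh_diag_le (w : Vh K ΓD p) :
    formAh P K ΓD p (0, w, fun _ => w) (0, w, fun _ => w) ≤ P.bound * normH1 Ω w ^ 2 := by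
  have h1 : aEForm K ΓD p P w w ≤ _ := gradForm_mono K ΓD p (F' := frobForm) (densityE_le P) w
  have h2 : ∀ m, aVEForm K ΓD p P m w w ≤ _ := fun m =>
    gradForm_mono K ΓD p (F' := frobForm) (densityVE_le P m) w
  have h3 := mul_le_mul_of_nonneg_left (gradForm_frob_le_normH1_sq K ΓD p w) P.bound_nonneg
  have h4 := Finset.sum_le_sum fun m (_ : m ∈ Finset.univ) => h2 m
  rw [← Finset.sum_mul] at h4
  refine le_trans ?_ h3
  simp only [formAh_apply, map_zero, mul_zero, zero_add]
  rw [Material.bound]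
  linarith

/-- Testing with $(w,0,0)$ turns the coupling terms of $B$ into one $A$-product:
$\rho(b_1,w)=-A((0,w,(w)_m),u)$. Cauchy–Schwarz for $A$ and `formAh_diag_le` then finish. -/
lemma normHm1_le {b u : State M (Vh K ΓD p)}
    (h : ∀ W, formAh P K ΓD p W b = formBh P K ΓD p W u) :
    normHm1 K ΓD p b.1
      ≤ ENNReal.ofReal √(P.rho⁻¹ ^ 2 * P.bound * formAh P K ΓD p u u) := by
  refine iSup₂_le fun w _ => ENNReal.ofReal_le_ofReal ?_
  have hH : 0 ≤ normH1 Ω w := Real.sqrt_nonneg _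
  refine div_le_of_le_mul₀ hH (Real.sqrt_nonneg _) ?_
  rw [← Real.sqrt_sq hH, ← Real.sqrt_mul' _ (sq_nonneg _)]
  refine Real.le_sqrt_of_sq_le ?_
  have h2 : P.rho * l2Form K ΓD p b.1 w = - formAh P K ΓD p (0, w, fun _ => w) u := by
    have h1 := h (w, 0, 0)
    simp only [formAh_apply, formBh_apply, map_zero, LinearMap.zero_apply, Pi.zero_apply,
      mul_zero, Finset.sum_const_zero, add_zero, Finset.sum_neg_distrib,
      zero_sub, zero_add] at h1 ⊢
    rw [l2Form_symm, h1]
    ring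
  have h3 := LinearMap.BilinForm.apply_sq_le_of_symm (formAh P K ΓD p) (formAh_nonneg P)
    ⟨formAh_symm P⟩ (0, w, fun _ => w) u
  have h4 : l2Form K ΓD p b.1 w ^ 2
      = P.rho⁻¹ ^ 2 * formAh P K ΓD p (0, w, fun _ => w) u ^ 2 := by
    have := P.rho_pos.ne'
    rw [← neg_sq (formAh P K ΓD p _ _), ← h2]
    field_simp
  have h5 := mul_le_mul_of_nonneg_left (h3.trans
    (mul_le_mul_of_nonneg_right (formAh_diag_le P w) (formAh_nonneg P u)))
    (sq_nonneg P.rho⁻¹)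
  rw [← l2Form_apply, h4]
  linarith

lemma aVEForm_sub_le (m : Fin M) (u v : Vh K ΓD p) :
    aVEForm K ΓD p P m (u - v) (u - v)
      ≤ 2 * aVEForm K ΓD p P m u u + 2 * aVEForm K ΓD p P m v v := by
  have h := aVEForm_nonneg P K ΓD p m (u + v)
  simp only [map_add, map_sub, LinearMap.add_apply, LinearMap.sub_apply] at h ⊢
  linarith

/-- The component of $Su$ is $u_1+\tau_m^{-1}u_{VE}^m$, with the opposite sign on $u_1$. The
correction $2u_1$ is paid for by the component $u_1$ of $Su$ in the elastic norm, since
$a_{VE}^m\le\frac{\kappa_m}{2\mu}a_E$; this gives $2+2\cdot4\cdot\frac{\kappa_m}{2\mu}$. -/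
lemma aVEForm_generator_le (hΩ : IsOpen Ω) (m : Fin M) (u : State M (Vh K ΓD p)) :
    aVEForm K ΓD p P m (-u.1 + (P.tau m)⁻¹ • u.2.2 m) (-u.1 + (P.tau m)⁻¹ • u.2.2 m)
      ≤ (2 + 4 * P.kappa m / P.mu)
        * formAh P K ΓD p (generator P K ΓD p hΩ u) (generator P K ΓD p hΩ u) := by
  have h1 := aVEForm_le_formAh P m (generator P K ΓD p hΩ u)
  have h2 := aEForm_le_formAh P (generator P K ΓD p hΩ u)
  have h3 := aVEForm_le_aEForm P K ΓD p m u.1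
  have h4 := aVEForm_sub_le P m (u.1 + (P.tau m)⁻¹ • u.2.2 m) ((2 : ℝ) • u.1)
  have h5 : u.1 + (P.tau m)⁻¹ • u.2.2 m - (2 : ℝ) • u.1 = -u.1 + (P.tau m)⁻¹ • u.2.2 m := by module
  have hk := P.kappa_pos m
  have hmu := P.mu_pos
  have h6 := mul_le_mul_of_nonneg_left h2 (by positivity : 0 ≤ P.kappa m / (2 * P.mu))
  set a := formAh P K ΓD p (generator P K ΓD p hΩ u) (generator P K ΓD p hΩ u)
  rw [h5] at h4
  simp only [generator_apply] at h1 h6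
  simp only [map_smul, LinearMap.smul_apply, smul_eq_mul] at h4
  have h7 : 4 * P.kappa m / P.mu = 8 * (P.kappa m / (2 * P.mu)) := by field_simp; norm_num
  rw [h7]
  linarith

end Estimates

/-! ### Bounds in the max norm in time -/

section Bounds

variable {M : ℕ} {P : Material M} {Ω : Set E3} {K : TetMesh Ω} {ΓD : Set E3} {p : ℕ} {T : ℝ}
  {τ : TimeMesh T} {Ψ : State M (Vh K ΓD p)} {Φ : ℝ → State M (Vh K ΓD p)}

lemma IsDualSolution.supNorm_normHm1_sq_le (h : IsDualSolution P τ Ψ Φ) (hT : 0 < T) :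
    supNorm (Icc 0 T \ range τ.node)
        (fun s => normHm1 K ΓD p (fieldDeriv (fun r => (Φ r).1) s)) ^ 2
      ≤ ENNReal.ofReal (P.rho⁻¹ ^ 2 * P.bound * formAh P K ΓD p Ψ Ψ) := by
  have hc : 0 ≤ P.rho⁻¹ ^ 2 * P.bound := mul_nonneg (sq_nonneg _) P.bound_nonneg
  refine supNorm_sq_le (mul_nonneg hc (formAh_nonneg P Ψ)) fun s hs => ?_
  obtain ⟨b, s', hs', hb, hW⟩ := h.exists_fieldDeriv hT hs
  rw [hb]
  exact (normHm1_le P hW).trans (ENNReal.ofReal_le_ofReal (Real.sqrt_le_sqrt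
    (mul_le_mul_of_nonneg_left (h.energy_le hT hs') hc)))

lemma IsDualSolution.supNorm_normA_sq_le (h : IsDualSolution P τ Ψ Φ) (hT : 0 < T) :
    supNorm (Icc 0 T) (fun s => ENNReal.ofReal (normA P Ω (Φ s).fields)) ^ 2
      ≤ ENNReal.ofReal (formAh P K ΓD p Ψ Ψ) :=
  supNorm_sq_le (formAh_nonneg P Ψ) fun _ hs =>
    ENNReal.ofReal_le_ofReal (Real.sqrt_le_sqrt (h.energy_le hT hs))

lemma IsDualSolution.dissipation_le (h : IsDualSolution P τ Ψ Φ) :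
    ∑ m, 2 / P.tau m * ∫ s in (0 : ℝ)..T,
        normVE P m Ω (projP0 τ (fun r => (Φ r).2.2 m) s) ^ 2 ≤ formAh P K ΓD p Ψ Ψ := by
  have h1 := h.energy 0 (Fin.last _) (Fin.zero_le _)
  simp only [τ.node_zero, τ.node_last, h.final] at h1
  have h2 := formAh_nonneg P (Φ 0)
  linarith

/-- For such data $S\Psi=(-\rho^{-1}\mathcal L_{h,E}\Psi_0,0,0)$, and the weight $\rho$ in $A$
leaves $\rho\cdot\rho^{-2}$. -/
lemma formAh_generator_of_eq_zero (hΩ : IsOpen Ω) (h1 : Ψ.1 = 0) (h2 : Ψ.2.2 = 0) :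
    formAh P K ΓD p (generator P K ΓD p hΩ Ψ) (generator P K ΓD p hΩ Ψ)
      = P.rho⁻¹ * normL2 Ω (opE P hΩ K ΓD p Ψ.2.1) ^ 2 := by
  have h3 : normL2 Ω (opE P hΩ K ΓD p Ψ.2.1) ^ 2
      = l2Form K ΓD p (opE P hΩ K ΓD p Ψ.2.1) (opE P hΩ K ΓD p Ψ.2.1) :=
    Real.sq_sqrt (l2Form_nonneg K ΓD p _)
  have := P.rho_pos.ne'
  rw [h3, formAh_apply, generator_apply]
  simp only [h1, h2, Pi.zero_apply, map_zero, smul_zero, add_zero, Finset.sum_const_zero,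
    map_neg, map_smul, LinearMap.neg_apply, LinearMap.smul_apply, smul_eq_mul]
  field_simp

lemma rho_l2Form_opE_le (hΩ : IsOpen Ω) (u : State M (Vh K ΓD p)) :
    l2Form K ΓD p (opE P hΩ K ΓD p u.2.1 + ∑ m, opVE P m hΩ K ΓD p (u.2.2 m))
        (opE P hΩ K ΓD p u.2.1 + ∑ m, opVE P m hΩ K ΓD p (u.2.2 m))
      ≤ P.rho * formAh P K ΓD p (generator P K ΓD p hΩ u) (generator P K ΓD p hΩ u) := by
  have h := rho_l2Form_le_formAh P (generator P K ΓD p hΩ u)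
  set a := formAh P K ΓD p (generator P K ΓD p hΩ u) (generator P K ΓD p hΩ u)
  have hr := P.rho_pos
  simp only [generator_apply, map_neg, map_smul, LinearMap.neg_apply, LinearMap.smul_apply,
    smul_eq_mul] at h
  have h' := mul_le_mul_of_nonneg_left h hr.le
  refine le_trans (le_of_eq ?_) h'
  field_simp

lemma IsDualSolution.supNorm_normL2_fieldDeriv_sq_le (h : IsDualSolution P τ Ψ Φ)
    (hΩ : IsOpen Ω) (hT : 0 < T) :
    supNorm (Icc 0 T \ range τ.node)
        (fun s => ENNReal.ofReal (normL2 Ω (fieldDeriv (fun r => (Φ r).1) s))) ^ 2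
      ≤ ENNReal.ofReal (P.rho⁻¹
        * formAh P K ΓD p (generator P K ΓD p hΩ Ψ) (generator P K ΓD p hΩ Ψ)) := by
  have hr := P.rho_pos
  refine supNorm_sq_le (mul_nonneg (inv_nonneg.2 hr.le) (formAh_nonneg P _)) fun s hs => ?_
  obtain ⟨b, s', hs', hb, hW⟩ := h.exists_fieldDeriv hT hs
  rw [hb]
  refine ENNReal.ofReal_le_ofReal (Real.sqrt_le_sqrt ?_)
  rw [← l2Form_apply, le_inv_mul_iff₀ hr]
  refine (rho_l2Form_le_formAh P b).trans ?_
  -- $A(b,b)=A(S\Phi(s'),S\Phi(s'))$, by exchanging the two arguments one after the other, although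
  -- $b$ and $S\Phi(s')$ may differ by an element of the kernel of $A$.
  rw [hW, ← formAh_generator P hΩ, formAh_symm, hW, ← formAh_generator P hΩ]
  exact h.generator_energy_le hΩ hT hs'

lemma IsDualSolution.supNorm_normL2_op_sq_le (h : IsDualSolution P τ Ψ Φ)
    (hΩ : IsOpen Ω) (hT : 0 < T) :
    supNorm (Icc 0 T) (fun s => ENNReal.ofReal (normL2 Ω
        (opE P hΩ K ΓD p (Φ s).2.1 + ∑ m, opVE P m hΩ K ΓD p ((Φ s).2.2 m) : Vh K ΓD p))) ^ 2
      ≤ ENNReal.ofReal (P.rho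
        * formAh P K ΓD p (generator P K ΓD p hΩ Ψ) (generator P K ΓD p hΩ Ψ)) :=
  supNorm_sq_le (mul_nonneg P.rho_pos.le (formAh_nonneg P _)) fun _ hs =>
    ENNReal.ofReal_le_ofReal (Real.sqrt_le_sqrt ((rho_l2Form_opE_le hΩ _).trans
      (mul_le_mul_of_nonneg_left (h.generator_energy_le hΩ hT hs) P.rho_pos.le)))

lemma IsDualSolution.supNorm_normE_sq_le (h : IsDualSolution P τ Ψ Φ)
    (hΩ : IsOpen Ω) (hT : 0 < T) :
    supNorm (Icc 0 T) (fun s => ENNReal.ofReal (normE P Ω (Φ s).1)) ^ 2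
      ≤ ENNReal.ofReal (formAh P K ΓD p (generator P K ΓD p hΩ Ψ) (generator P K ΓD p hΩ Ψ)) :=
  supNorm_sq_le (formAh_nonneg P _) fun s hs =>
    ENNReal.ofReal_le_ofReal (Real.sqrt_le_sqrt
      ((aEForm_le_formAh P (generator P K ΓD p hΩ (Φ s))).trans (h.generator_energy_le hΩ hT hs)))

lemma Material.dev_bound_nonneg (P : Material M) (m : Fin M) :
    0 ≤ 2 + 4 * P.kappa m / P.mu := by
  have := P.kappa_pos m
  have := P.mu_pos
  positivity

lemma IsDualSolution.supNorm_normVE_sq_le (h : IsDualSolution P τ Ψ Φ)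
    (hΩ : IsOpen Ω) (hT : 0 < T) (m : Fin M) :
    supNorm (Icc 0 T) (fun s => ENNReal.ofReal (normVE P m Ω
        (-(Φ s).1 + (P.tau m)⁻¹ • (Φ s).2.2 m : Vh K ΓD p))) ^ 2
      ≤ ENNReal.ofReal ((2 + 4 * P.kappa m / P.mu)
        * formAh P K ΓD p (generator P K ΓD p hΩ Ψ) (generator P K ΓD p hΩ Ψ)) :=
  supNorm_sq_le (mul_nonneg (P.dev_bound_nonneg m) (formAh_nonneg P _)) fun _ hs =>
    ENNReal.ofReal_le_ofReal (Real.sqrt_le_sqrt ((aVEForm_generator_le P hΩ m _).trans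
      (mul_le_mul_of_nonneg_left (h.generator_energy_le hΩ hT hs) (P.dev_bound_nonneg m))))

end Bounds

end

end Visco

/-! ### The lemma -/

open Visco in
theorem mainTheorem3 {M : ℕ} (P : Material M) (Ω : Set E3) (hΩ : IsOpen Ω) (ΓD : Set E3)
    (hΓD : ΓD ⊆ frontier Ω) (p : ℕ) :
    ∃ C : ℝ, 0 < C ∧
      ∀ (K : TetMesh Ω) (T : ℝ) (_ : 0 < T) (τ : TimeMesh T) (Ψ : State M (Vh K ΓD p))
        (Φ : ℝ → State M (Vh K ΓD p)), IsDualSolution P τ Ψ Φ →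
        (∀ i j : Fin (τ.N + 1), i ≤ j →
          normA P Ω (Φ (τ.node i)).fields ^ 2
            + ∑ m, 2 / P.tau m * ∫ s in (τ.node i)..(τ.node j),
                normVE P m Ω (projP0 τ (fun r => (Φ r).2.2 m) s) ^ 2
            = normA P Ω (Φ (τ.node j)).fields ^ 2) ∧
        supNorm (Icc 0 T \ range τ.node)
              (fun s => normHm1 K ΓD p (fieldDeriv (fun r => (Φ r).1) s)) ^ 2
            + supNorm (Icc 0 T) (fun s => ENNReal.ofReal (normA P Ω (Φ s).fields)) ^ 2
            + ENNReal.ofReal (∑ m, 2 / P.tau m * ∫ s in (0 : ℝ)..T,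
                normVE P m Ω (projP0 τ (fun r => (Φ r).2.2 m) s) ^ 2)
          ≤ ENNReal.ofReal (C * normA P Ω Ψ.fields ^ 2) ∧
        (Ψ.1 = 0 → Ψ.2.2 = 0 →
          supNorm (Icc 0 T \ range τ.node)
                (fun s => ENNReal.ofReal (normL2 Ω (fieldDeriv (fun r => (Φ r).1) s))) ^ 2
              + supNorm (Icc 0 T) (fun s => ENNReal.ofReal (normL2 Ω
                  (opE P hΩ K ΓD p (Φ s).2.1 + ∑ m, opVE P m hΩ K ΓD p ((Φ s).2.2 m) :
                    Vh K ΓD p))) ^ 2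
              + supNorm (Icc 0 T) (fun s => ENNReal.ofReal (normE P Ω (Φ s).1)) ^ 2
              + ∑ m, supNorm (Icc 0 T) (fun s => ENNReal.ofReal (normVE P m Ω
                  (-(Φ s).1 + (P.tau m)⁻¹ • (Φ s).2.2 m : Vh K ΓD p))) ^ 2
            ≤ ENNReal.ofReal (C * normL2 Ω (opE P hΩ K ΓD p Ψ.2.1) ^ 2)) := by
  have hr := P.rho_pos
  have hS : 0 ≤ ∑ m, (2 + 4 * P.kappa m / P.mu) :=
    Finset.sum_nonneg fun m _ => P.dev_bound_nonneg m
  have hc1 : 0 ≤ P.rho⁻¹ ^ 2 * P.bound := mul_nonneg (sq_nonneg _) P.bound_nonneg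
  have hc2 : 0 ≤ (P.rho⁻¹ + P.rho + 1 + ∑ m, (2 + 4 * P.kappa m / P.mu)) * P.rho⁻¹ := by positivity
  -- The first bracket sums the constants of the three terms of (ii). The rest sums those of (iii),
  -- times the $\rho^{-1}$ of `formAh_generator_of_eq_zero`. Both being nonnegative, their sum
  -- serves for either estimate.
  refine ⟨(P.rho⁻¹ ^ 2 * P.bound + 1 + 1)
    + (P.rho⁻¹ + P.rho + 1 + ∑ m, (2 + 4 * P.kappa m / P.mu)) * P.rho⁻¹, by positivity, ?_⟩
  intro K T hT τ Ψ Φ h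
  refine ⟨fun i j hij => ?_, ?_, fun h1 h2 => ?_⟩
  · rw [normA_sq, normA_sq]
    exact h.energy i j hij
  · have hA := formAh_nonneg P Ψ
    rw [normA_sq]
    refine (add_le_add (add_le_add (h.supNorm_normHm1_sq_le hT) (h.supNorm_normA_sq_le hT))
      (ENNReal.ofReal_le_ofReal h.dissipation_le)).trans ?_
    rw [← ENNReal.ofReal_add (mul_nonneg hc1 hA) hA, ← ENNReal.ofReal_add (by positivity) hA]
    refine ENNReal.ofReal_le_ofReal ?_
    linarith [mul_nonneg hc2 hA]
  · have hY := formAh_nonneg P (generator P K ΓD p hΩ Ψ)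
    have hL := sq_nonneg (normL2 Ω (opE P hΩ K ΓD p Ψ.2.1))
    refine (add_le_add (add_le_add (add_le_add (h.supNorm_normL2_fieldDeriv_sq_le hΩ hT)
      (h.supNorm_normL2_op_sq_le hΩ hT)) (h.supNorm_normE_sq_le hΩ hT))
      (Finset.sum_le_sum fun m _ => h.supNorm_normVE_sq_le hΩ hT m)).trans ?_
    rw [← ENNReal.ofReal_sum_of_nonneg fun m _ => mul_nonneg (P.dev_bound_nonneg m) hY,
      ← Finset.sum_mul, ← ENNReal.ofReal_add (by positivity) (by positivity),
      ← ENNReal.ofReal_add (by positivity) (by positivity),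
      ← ENNReal.ofReal_add (by positivity) (by positivity), formAh_generator_of_eq_zero hΩ h1 h2]
    refine ENNReal.ofReal_le_ofReal ?_
    linarith [mul_nonneg hc1 hL]
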